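/- For a group $X$ let $\hat X=\varprojlim X/N$ ($N$ ranging over the normal subgroups of finite index) be its profinite completion. Let $\Gamma$ be a finitely generated nilpotent group, let $\bar\Gamma=\Gamma/[\Gamma,\Gamma]$ and $\Gamma^*=\bar\Gamma/\mathrm{tor}(\bar\Gamma)$, and put $$IA^*(\Gamma)=\ker\bigl(\mathrm{Aut}(\Gamma)\to\mathrm{Aut}(\Gamma^*)\bigr),\qquad IA^*(\hat\Gamma)=\ker\bigl(\mathrm{Aut}(\hat\Gamma)\to\mathrm{Aut}(\widehat{\Gamma^*})\bigr),$$ where $\mathrm{Aut}(\hat\Gamma)$ is the group of continuous automorphisms of $\hat\Gamma$ with the compact-open topology (equivalently, the topology of uniform convergence). For $G\le\mathrm{Aut}(\Gamma)$ and a characteristic subgroup $M\le\Gamma$ of finite index let $G(M)=\ker(G\to\mathrm{Aut}(\Gamma/M))$; the actions of $G/G(M)$ on $\Gamma/M$ induce in the limit the congruence map $\hat G\to\mathrm{Aut}(\hat\Gamma)$, whose kernel is denoted $C(G,\Gamma)$. 1. For every subgroup $G\le IA^*(\Gamma)$, the natural map $G\to IA^*(\hat\Gamma)$ is injective and the congruence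 map takes values in $IA^*(\hat\Gamma)$ and is injective as a map $\hat G\to IA^*(\hat\Gamma)$. In other words, $C(G,\Gamma)=\{e\}$, and the congruence subgroup problem for $(G,\Gamma)$ has an affirmative solution: every finite index subgroup of $G$ contains $G(M)$ for some characteristic subgroup $M$ of finite index in $\Gamma$. 2. The image of $IA^*(\Gamma)$ under the natural map $\mathrm{Aut}(\Gamma)\to\mathrm{Aut}(\hat\Gamma)$ is a dense subgroup of $IA^*(\hat\Gamma)$. -/

import Mathlib

universe u

namespace NilpotentCSP

/-! ### Profinite completions -/

/-- The profinite completion `Ĝ = lim G ⧸ N`, over all normal subgroups `N` of finite index. -/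
abbrev Completion (G : Type u) [Group G] : ProfiniteGrp.{u} :=
  ProfiniteGrp.ProfiniteCompletion.completion (GrpCat.of G)

/-- The canonical homomorphism `G → Ĝ`. -/
def toCompletion (G : Type u) [Group G] : G →* Completion G :=
  (ProfiniteGrp.ProfiniteCompletion.eta (GrpCat.of G)).hom

/-- The projection `Ĝ → G ⧸ N`. -/
def proj {G : Type u} [Group G] (N : FiniteIndexNormalSubgroup G) :
    Completion G →* G ⧸ N.toSubgroup where
  toFun x := x.1 N
  map_one' := rfl
  map_mul' _ _ := rfl

/-- The projection `G ⧸ M → G ⧸ N` for `M ≤ N`. -/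
def reduce {G : Type u} [Group G] {M N : Subgroup G} [M.Normal] [N.Normal] (h : M ≤ N) :
    G ⧸ M →* G ⧸ N :=
  QuotientGroup.map M N (MonoidHom.id G) h

theorem reduce_reduce {G : Type u} [Group G] {M N O : Subgroup G} [M.Normal] [N.Normal]
    [O.Normal] (h : M ≤ N) (h' : N ≤ O) (x : G ⧸ M) :
    reduce h' (reduce h x) = reduce (h.trans h') x := by
  obtain ⟨x, rfl⟩ := QuotientGroup.mk_surjective x
  rfl

theorem reduce_self {G : Type u} [Group G] {M : Subgroup G} [M.Normal] (h : M ≤ M) (x : G ⧸ M) :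
    reduce h x = x := by
  obtain ⟨x, rfl⟩ := QuotientGroup.mk_surjective x
  rfl

/-- The continuous homomorphism `Ĝ → Ĥ` induced by a homomorphism `G → H`. -/
noncomputable def completionMap {G H : Type u} [Group G] [Group H] (f : G →* H) :
    Completion G →ₜ* Completion H :=
  (ProfiniteGrp.profiniteCompletion.map (GrpCat.ofHom f)).hom

section CompletionFacts

open CategoryTheory

variable {G : Type u} [Group G]

theorem completion_ext {x y : Completion G} (h : ∀ N, proj N x = proj N y) : x = y :=
  Subtype.ext (funext h)

theorem proj_toCompletion (N : FiniteIndexNormalSubgroup G) (g : G) :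
    proj N (toCompletion G g) = QuotientGroup.mk g := rfl

theorem map_proj {M N : FiniteIndexNormalSubgroup G} (h : M.toSubgroup ≤ N.toSubgroup)
    (x : Completion G) :
    reduce h (proj M x) = proj N x := by
  have h' : M ≤ N := h
  exact x.2 (CategoryTheory.homOfLE h')

theorem denseRange_toCompletion : DenseRange (toCompletion G) :=
  ProfiniteGrp.ProfiniteCompletion.denseRange (GrpCat.of G)

theorem isLocallyConstant_proj (N : FiniteIndexNormalSubgroup G) :
    IsLocallyConstant (proj N : Completion G → G ⧸ N.toSubgroup) := by
  let D := (ProfiniteGrp.ProfiniteCompletion.diagram (GrpCat.of G)).obj N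
  have hD : DiscreteTopology D := ⟨rfl⟩
  have h : Continuous fun x : Completion G => (x.1 N : D) :=
    (continuous_apply N).comp continuous_subtype_val
  exact fun s => IsOpen.preimage h (isOpen_discrete (α := D) s)

theorem continuous_of_proj {X : Type*} [TopologicalSpace X] {f : X → Completion G}
    (h : ∀ N, IsLocallyConstant fun x => proj N (f x)) : Continuous f := by
  exact continuous_induced_rng.2 (continuous_pi fun N => continuous_def.2 fun s _ => h N s)

theorem completionMap_toCompletion {H : Type u} [Group H] (f : G →* H) (g : G) :
    completionMap f (toCompletion G g) = toCompletion H (f g) := by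
  have := ProfiniteGrp.ProfiniteCompletion.lift_eta
    (GrpCat.ofHom f ≫ ProfiniteGrp.ProfiniteCompletion.eta (GrpCat.of H))
  exact CategoryTheory.ConcreteCategory.congr_hom this g

theorem completionMap_ext {P : Type*} [TopologicalSpace P] [T2Space P]
    {f f' : Completion G → P} (hf : Continuous f) (hf' : Continuous f')
    (h : ∀ g, f (toCompletion G g) = f' (toCompletion G g)) : f = f' :=
  denseRange_toCompletion.equalizer hf hf' (funext h)

end CompletionFacts

/-! ### Groups of automorphisms -/

/-- The group `Aut(X)` of continuous (in both directions) automorphisms of a topological group. -/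
def ContAut (X : Type u) [Group X] [TopologicalSpace X] : Subgroup (MulAut X) where
  carrier := {φ | Continuous φ ∧ Continuous φ.symm}
  one_mem' := ⟨continuous_id, continuous_id⟩
  mul_mem' := fun {_ _} ha hb => ⟨ha.1.comp hb.1, hb.2.comp ha.2⟩
  inv_mem' := fun {_} ha => ⟨ha.2, ha.1⟩

/-- A continuous automorphism as an element of `C(X, X)`. -/
def ContAut.toContinuousMap {X : Type u} [Group X] [TopologicalSpace X] (φ : ContAut X) :
    C(X, X) := ⟨φ.1, φ.2.1⟩

/-- `Aut(X)` carries the compact-open topology. (For `X` profinite this is the topology of uniform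
convergence: the automorphisms congruent to a given one modulo an open normal subgroup form a
basic neighbourhood of it.) -/
instance (X : Type u) [Group X] [TopologicalSpace X] : TopologicalSpace (ContAut X) :=
  TopologicalSpace.induced ContAut.toContinuousMap ContinuousMap.compactOpen

/-- The natural homomorphism `Aut(Γ) → Aut(Γ̂)`. -/
noncomputable def autCompletion (Γ : Type u) [Group Γ] :
    MulAut Γ →* ContAut (Completion Γ) :=
  have key : ∀ (φ ψ : MulAut Γ) (x : Completion Γ),
      completionMap φ.toMonoidHom (completionMap ψ.toMonoidHom x) =
        completionMap (φ * ψ).toMonoidHom x := fun φ ψ x =>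
    congrFun (completionMap_ext (((completionMap φ.toMonoidHom).continuous_toFun).comp
      (completionMap ψ.toMonoidHom).continuous_toFun)
      (completionMap (φ * ψ).toMonoidHom).continuous_toFun (fun g => by
        change completionMap φ.toMonoidHom (completionMap ψ.toMonoidHom (toCompletion Γ g)) =
          completionMap (φ * ψ).toMonoidHom (toCompletion Γ g)
        simp only [completionMap_toCompletion]
        rfl)) x
  have key1 : ∀ x : Completion Γ, completionMap (1 : MulAut Γ).toMonoidHom x = x := fun x =>
    congrFun (completionMap_ext (completionMap (1 : MulAut Γ).toMonoidHom).continuous_toFun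
      continuous_id (fun g => completionMap_toCompletion _ g)) x
  { toFun := fun φ =>
      ⟨{ toFun := completionMap φ.toMonoidHom
         invFun := completionMap (φ⁻¹).toMonoidHom
         left_inv := fun x => by rw [key, inv_mul_cancel, key1]
         right_inv := fun x => by rw [key, mul_inv_cancel, key1]
         map_mul' := map_mul _ },
       (completionMap φ.toMonoidHom).continuous_toFun,
       (completionMap (φ⁻¹).toMonoidHom).continuous_toFun⟩
    map_one' := Subtype.ext (MulEquiv.ext key1)
    map_mul' := fun φ ψ => Subtype.ext (MulEquiv.ext fun x => (key φ ψ x).symm) }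

theorem autCompletion_toCompletion {Γ : Type u} [Group Γ] (φ : MulAut Γ) (γ : Γ) :
    (autCompletion Γ φ).1 (toCompletion Γ γ) = toCompletion Γ (φ γ) :=
  completionMap_toCompletion _ γ

/-! ### The quotient `Γ*` and the groups `IA*` -/

/-- `Γ* = Γᵃᵇ ⧸ tor(Γᵃᵇ)`, where `Γᵃᵇ = Γ ⧸ [Γ, Γ]`. -/
abbrev Star (Γ : Type u) [Group Γ] : Type u :=
  Abelianization Γ ⧸ CommGroup.torsion (Abelianization Γ)

/-- The projection `Γ → Γ*`. -/
def toStar (Γ : Type u) [Group Γ] : Γ →* Star Γ :=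
  (QuotientGroup.mk' (CommGroup.torsion (Abelianization Γ))).comp Abelianization.of

/-- The natural homomorphism `Aut(Γ) → Aut(Γ*)`. -/
def autStar (Γ : Type u) [Group Γ] : MulAut Γ →* MulAut (Star Γ) where
  toFun φ := QuotientGroup.congr _ _ (MulEquiv.abelianizationCongr φ) (MulEquiv.map_torsion _)
  map_one' := by
    ext x
    obtain ⟨x, rfl⟩ := QuotientGroup.mk_surjective x
    obtain ⟨x, rfl⟩ := QuotientGroup.mk_surjective x
    rfl
  map_mul' φ ψ := by
    ext x
    obtain ⟨x, rfl⟩ := QuotientGroup.mk_surjective x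
    obtain ⟨x, rfl⟩ := QuotientGroup.mk_surjective x
    rfl

theorem autStar_toStar {Γ : Type u} [Group Γ] (φ : MulAut Γ) (γ : Γ) :
    autStar Γ φ (toStar Γ γ) = toStar Γ (φ γ) := rfl

/-- `IA*(Γ) = ker (Aut(Γ) → Aut(Γ*))`. -/
def IAStar (Γ : Type u) [Group Γ] : Subgroup (MulAut Γ) := (autStar Γ).ker

/-- `IA*(Γ̂)`, the kernel of the natural map from `Aut(Γ̂)` to the automorphisms of the profinite
completion of `Γ*`: with `π : Γ̂ → (Γ*)^` the natural map, the automorphism induced by `α` is the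
`β` with `β ∘ π = π ∘ α`, and it is trivial if and only if `π ∘ α = π`. -/
def IAStarHat (Γ : Type u) [Group Γ] : Subgroup (ContAut (Completion Γ)) where
  carrier := {α | ∀ x, completionMap (toStar Γ) (α.1 x) = completionMap (toStar Γ) x}
  one_mem' := fun _ => rfl
  mul_mem' := fun {a b} ha hb x => (ha (b.1 x)).trans (hb x)
  inv_mem' := fun {a} ha x => by
    have h := ha (a.1.symm x)
    rw [MulEquiv.apply_symm_apply] at h
    exact h.symm

theorem autCompletion_mem {Γ : Type u} [Group Γ] {φ : MulAut Γ} (hφ : φ ∈ IAStar Γ) :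
    autCompletion Γ φ ∈ IAStarHat Γ := fun x =>
  congrFun (completionMap_ext
    (((completionMap (toStar Γ)).continuous_toFun).comp (autCompletion Γ φ).2.1)
    (completionMap (toStar Γ)).continuous_toFun (fun γ => by
      change completionMap (toStar Γ) ((autCompletion Γ φ).1 (toCompletion Γ γ)) =
        completionMap (toStar Γ) (toCompletion Γ γ)
      rw [autCompletion_toCompletion, completionMap_toCompletion, completionMap_toCompletion,
        ← autStar_toStar, show autStar Γ φ = 1 from hφ]
      rfl)) x

/-- The natural homomorphism `IA*(Γ) → IA*(Γ̂)`. -/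
noncomputable def iaCompletion (Γ : Type u) [Group Γ] : IAStar Γ →* IAStarHat Γ :=
  ((autCompletion Γ).comp (IAStar Γ).subtype).codRestrict (IAStarHat Γ)
    fun φ => autCompletion_mem φ.2

/-! ### Congruence subgroups -/

/-- The action of `Aut(Γ)` on `Γ ⧸ M`, for a characteristic subgroup `M`. -/
def autQuotient {Γ : Type u} [Group Γ] (M : Subgroup Γ) [hM : M.Characteristic] :
    MulAut Γ →* MulAut (Γ ⧸ M) where
  toFun φ := QuotientGroup.congr M M φ (Subgroup.characteristic_iff_map_eq.1 hM φ)
  map_one' := by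
    ext x
    obtain ⟨x, rfl⟩ := QuotientGroup.mk_surjective x
    rfl
  map_mul' φ ψ := by
    ext x
    obtain ⟨x, rfl⟩ := QuotientGroup.mk_surjective x
    rfl

/-- The principal congruence subgroup `G(M) = ker (G → Aut(Γ ⧸ M))` of `G ≤ Aut(Γ)`. -/
def principal {Γ : Type u} [Group Γ] (G : Subgroup (MulAut Γ)) (M : Subgroup Γ)
    [M.Characteristic] : Subgroup G :=
  ((autQuotient M).comp G.subtype).ker

/-- A congruence subgroup of `G`: a finite index subgroup containing `G(M)` for some
characteristic subgroup `M` of finite index in `Γ`. -/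
def IsCongruenceSubgroup {Γ : Type u} [Group Γ] (G : Subgroup (MulAut Γ)) (H : Subgroup G) :
    Prop :=
  H.FiniteIndex ∧
    ∃ (M : Subgroup Γ) (_ : M.Characteristic), M.FiniteIndex ∧ principal G M ≤ H

/-! ### The congruence map `Ĝ → Aut(Γ̂)` -/

section Congruence

variable {Γ : Type u} [Group Γ] (G : Subgroup (MulAut Γ))

instance (M : FiniteIndexNormalSubgroup Γ) [M.toSubgroup.Characteristic] :
    (principal G M.toSubgroup).FiniteIndex := by
  unfold principal
  infer_instance

/-- `G(M)` as a normal subgroup of finite index. -/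
def principalFI (M : FiniteIndexNormalSubgroup Γ) [M.toSubgroup.Characteristic] :
    FiniteIndexNormalSubgroup G where
  toSubgroup := principal G M.toSubgroup
  isNormal' := MonoidHom.normal_ker _

/-- The homomorphism `Ĝ → G ⧸ G(M) → Aut(Γ ⧸ M)`. -/
def levelMap (M : FiniteIndexNormalSubgroup Γ) [M.toSubgroup.Characteristic] :
    Completion G →* MulAut (Γ ⧸ M.toSubgroup) :=
  (QuotientGroup.kerLift ((autQuotient M.toSubgroup).comp G.subtype)).comp
    (proj (principalFI G M))

theorem levelMap_of_proj {M : FiniteIndexNormalSubgroup Γ} [M.toSubgroup.Characteristic]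
    {g : Completion G} {h : G} (hg : proj (principalFI G M) g = QuotientGroup.mk h) :
    levelMap G M g = autQuotient M.toSubgroup h.1 := by
  change QuotientGroup.kerLift _ (proj (principalFI G M) g) = _
  rw [hg]
  rfl

theorem principal_mono {M M' : Subgroup Γ} [M.Characteristic] [M'.Characteristic]
    (h : M ≤ M') : principal G M ≤ principal G M' := by
  intro g hg
  have hg' : autQuotient M g.1 = 1 := hg
  change autQuotient M' g.1 = 1
  ext x
  obtain ⟨x, rfl⟩ := QuotientGroup.mk_surjective x
  have h1 : (QuotientGroup.mk (g.1 x) : Γ ⧸ M) = QuotientGroup.mk x :=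
    DFunLike.congr_fun hg' (QuotientGroup.mk x)
  exact QuotientGroup.eq.2 (h (QuotientGroup.eq.1 h1))

theorem map_levelMap {M M' : FiniteIndexNormalSubgroup Γ} [M.toSubgroup.Characteristic]
    [M'.toSubgroup.Characteristic] (h : M.toSubgroup ≤ M'.toSubgroup) (g : Completion G)
    (y : Γ ⧸ M.toSubgroup) :
    reduce h (levelMap G M g y) =
      levelMap G M' g (reduce h y) := by
  obtain ⟨k, hk⟩ := QuotientGroup.mk_surjective (proj (principalFI G M) g)
  have hk' : proj (principalFI G M') g = QuotientGroup.mk k := by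
    rw [← map_proj (M := principalFI G M) (N := principalFI G M') (principal_mono G h) g, ← hk]
    rfl
  obtain ⟨y, rfl⟩ := QuotientGroup.mk_surjective y
  rw [levelMap_of_proj G hk.symm, levelMap_of_proj G hk']
  rfl

instance (M M' : FiniteIndexNormalSubgroup Γ) [h : M.toSubgroup.Characteristic]
    [h' : M'.toSubgroup.Characteristic] : (M ⊓ M').toSubgroup.Characteristic :=
  Subgroup.characteristic_inf (H := M.toSubgroup) (K := M'.toSubgroup)

theorem map_levelMap_proj (N : FiniteIndexNormalSubgroup Γ) (M M' : FiniteIndexNormalSubgroup Γ)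
    [M.toSubgroup.Characteristic] [M'.toSubgroup.Characteristic]
    (h : M.toSubgroup ≤ N.toSubgroup) (h' : M'.toSubgroup ≤ N.toSubgroup)
    (g : Completion G) (x : Completion Γ) :
    reduce h (levelMap G M g (proj M x)) =
      reduce h' (levelMap G M' g (proj M' x)) := by
  have l : (M ⊓ M').toSubgroup ≤ M.toSubgroup := fun _ hx => hx.1
  have l' : (M ⊓ M').toSubgroup ≤ M'.toSubgroup := fun _ hx => hx.2
  rw [← map_proj l x, ← map_proj l' x, ← map_levelMap, ← map_levelMap, reduce_reduce,
    reduce_reduce]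

variable [Group.FG Γ]

theorem finite_hom (F : Type u) [Group F] [Finite F] : Finite (Γ →* F) := by
  obtain ⟨S, hS, hfin⟩ := Group.fg_iff.1 (inferInstance : Group.FG Γ)
  have := hfin.to_subtype
  refine Finite.of_injective (fun (f : Γ →* F) (s : S) => f s) fun f f' h => ?_
  exact MonoidHom.eq_of_eqOn_dense hS fun s hs => congrFun h ⟨s, hs⟩

/-- The largest characteristic subgroup contained in `N`. -/
def charCore (N : FiniteIndexNormalSubgroup Γ) : FiniteIndexNormalSubgroup Γ where
  toSubgroup := ⨅ φ : MulAut Γ, N.toSubgroup.comap φ.toMonoidHom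
  isNormal' := Subgroup.normal_iInf_normal fun _ => inferInstance
  isFiniteIndex' := by
    have := finite_hom (Γ := Γ) (Γ ⧸ N.toSubgroup)
    have : (⨅ f : Γ →* Γ ⧸ N.toSubgroup, f.ker).FiniteIndex :=
      Subgroup.finiteIndex_iInf fun f => inferInstance
    refine Subgroup.finiteIndex_of_le (H := ⨅ f : Γ →* Γ ⧸ N.toSubgroup, f.ker) ?_
    refine le_iInf fun φ => (iInf_le _ ((QuotientGroup.mk' N.toSubgroup).comp φ.toMonoidHom)).trans
      (fun x hx => ?_)
    exact (QuotientGroup.eq_one_iff (φ x)).1 hx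

instance (N : FiniteIndexNormalSubgroup Γ) : (charCore N).toSubgroup.Characteristic := by
  rw [Subgroup.characteristic_iff_le_comap]
  intro φ x hx
  have hx' : ∀ ψ : MulAut Γ, ψ x ∈ N.toSubgroup := fun ψ => Subgroup.mem_iInf.1 hx ψ
  exact Subgroup.mem_iInf.2 fun ψ => hx' (ψ * φ)

theorem charCore_le (N : FiniteIndexNormalSubgroup Γ) :
    (charCore N).toSubgroup ≤ N.toSubgroup :=
  iInf_le (fun φ : MulAut Γ => N.toSubgroup.comap φ.toMonoidHom) 1

/-- The action of `Ĝ` on `Γ̂`, obtained in the limit from the actions of `G ⧸ G(M)` on `Γ ⧸ M`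
for the characteristic subgroups `M` of finite index (which are cofinal, `Γ` being finitely
generated). -/
def act (g : Completion G) (x : Completion Γ) : Completion Γ :=
  ⟨fun N => reduce (charCore_le N)
      (levelMap G (charCore N) g (proj (charCore N) x)), by
    intro N N' f
    have hNN' : N.toSubgroup ≤ N'.toSubgroup := CategoryTheory.leOfHom f
    refine Eq.trans ?_ (map_levelMap_proj G N' (charCore N) (charCore N')
      ((charCore_le N).trans hNN') (charCore_le N') g x)
    exact reduce_reduce (charCore_le N) hNN' _⟩

/-- At a characteristic subgroup `M`, the element `g` acts through its image in `Aut(Γ ⧸ M)`. -/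
theorem proj_act (M : FiniteIndexNormalSubgroup Γ) [M.toSubgroup.Characteristic]
    (g : Completion G) (x : Completion Γ) :
    proj M (act G g x) = levelMap G M g (proj M x) := by
  refine (map_levelMap_proj G M (charCore M) M (charCore_le M) le_rfl g x).trans ?_
  exact reduce_self _ _

theorem completion_ext_char {x y : Completion Γ}
    (h : ∀ (M : FiniteIndexNormalSubgroup Γ) [M.toSubgroup.Characteristic],
      proj M x = proj M y) : x = y :=
  completion_ext fun N => by
    rw [← map_proj (charCore_le N), ← map_proj (charCore_le N), h]

theorem act_mul (g g' : Completion G) (x : Completion Γ) :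
    act G (g * g') x = act G g (act G g' x) :=
  completion_ext_char fun M _ => by simp only [proj_act, map_mul, MulAut.mul_apply]

theorem act_one (x : Completion Γ) : act G 1 x = x :=
  completion_ext_char fun M _ => by simp only [proj_act, map_one, MulAut.one_apply]

theorem act_map_mul (g : Completion G) (x y : Completion Γ) :
    act G g (x * y) = act G g x * act G g y :=
  completion_ext_char fun M _ => by simp only [proj_act, map_mul]

theorem continuous_act (g : Completion G) : Continuous (act G g) :=
  continuous_of_proj fun N =>
    (isLocallyConstant_proj (charCore N)).comp
      fun y => reduce (charCore_le N) (levelMap G (charCore N) g y)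

theorem continuous_act_left (x : Completion Γ) : Continuous fun g => act G g x :=
  continuous_of_proj fun N =>
    (isLocallyConstant_proj (principalFI G (charCore N))).comp
      fun k => reduce (charCore_le N)
        (QuotientGroup.kerLift ((autQuotient (charCore N).toSubgroup).comp G.subtype) k
          (proj (charCore N) x))

/-- The congruence map `Ĝ → Aut(Γ̂)`. -/
def congruenceMap : Completion G →* ContAut (Completion Γ) where
  toFun g :=
    ⟨{ toFun := act G g
       invFun := act G g⁻¹
       left_inv := fun x => by rw [← act_mul, inv_mul_cancel, act_one]
       right_inv := fun x => by rw [← act_mul, mul_inv_cancel, act_one]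
       map_mul' := act_map_mul G g }, continuous_act G g, continuous_act G g⁻¹⟩
  map_one' := Subtype.ext (MulEquiv.ext (act_one G))
  map_mul' g g' := Subtype.ext (MulEquiv.ext (act_mul G g g'))

/-- The congruence kernel `C(G, Γ) = ker (Ĝ → Aut(Γ̂))`. -/
def congruenceKernel : Subgroup (Completion G) := (congruenceMap G).ker

/-- The congruence map extends the natural map `G → Aut(Γ̂)`. -/
theorem congruenceMap_toCompletion (g : G) :
    congruenceMap G (toCompletion G g) = autCompletion Γ g.1 := by
  refine Subtype.ext (MulEquiv.ext fun x => ?_)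
  refine congrFun (completionMap_ext (continuous_act G (toCompletion G g))
    (autCompletion Γ g.1).2.1 fun γ => ?_) x
  refine Eq.trans ?_ (autCompletion_toCompletion g.1 γ).symm
  refine completion_ext_char fun M _ => ?_
  rw [proj_act]
  rfl

theorem congruenceMap_mem {G : Subgroup (MulAut Γ)} (hG : G ≤ IAStar Γ) (g : Completion G) :
    congruenceMap G g ∈ IAStarHat Γ := fun x =>
  congrFun (completionMap_ext
    (((completionMap (toStar Γ)).continuous_toFun).comp (continuous_act_left G x))
    (continuous_const (y := completionMap (toStar Γ) x)) fun k => by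
      have h := autCompletion_mem (hG k.2) x
      rw [← congruenceMap_toCompletion] at h
      exact h) g

/-- The congruence map `Ĝ → IA*(Γ̂)` of a subgroup `G ≤ IA*(Γ)`. -/
def iaCongruenceMap {G : Subgroup (MulAut Γ)} (hG : G ≤ IAStar Γ) :
    Completion G →* IAStarHat Γ :=
  (congruenceMap G).codRestrict (IAStarHat Γ) (congruenceMap_mem hG)

end Congruence

end NilpotentCSP

/-! In a finitely generated nilpotent group, approximate solutions modulo a deep finite index
subgroup lie near exact ones. This principle drives both halves. Its sources are residual
finiteness, in the form `exists_inf_le_of_pow`, and divisibility in finitely generated abelian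
groups, `exists_pow_imp_mem_mul_ker`.

Congruence subgroups. A group acting unipotently along a central filtration `F` is filtered by the
subgroups acting trivially modulo `F j`, and the successive quotients embed in finitely generated
abelian groups of central displacements `s⁻¹ * g s`. If `g` is trivial modulo a deep subgroup, its
displacements are high powers, so `g` can be treated layer by layer; this gives
`exists_congruence_le`. For `G ≤ IA*(Γ)` the displacements are torsion modulo `[Γ, Γ]`, hence a
congruence subgroup of `G` acts trivially on `Γᵃᵇ`, and so unipotently on the lower central series.
Injectivity on `Ĝ` follows formally, and injectivity on `G` is residual finiteness of `Γ`.

Density. It suffices to realise `α ∈ IA*(Γ̂)` modulo each finite index normal subgroup.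
Representatives of the values of `α` form a map `a : Γ → Γ` which is a homomorphism modulo a deep
subgroup. The isolated lower central series has torsion free quotients and a finite term `T`; being
trivial on `Γ*`, the map `a` is nearly trivial on the layers above `T`
(`exists_isHomMod_imp_mem_isolated`). On `Γ ⧸ T` such a map is near an automorphism
(`hasApproximation_of_isIsolated`). There one writes `N = ker π ⋊ ⟨t⟩`, approximates on `ker π` by
induction, and corrects the result until it is compatible with `t` (`hasApproximation_of_ker`). The
correction takes place in the stability group of `ker π`, which is again finitely generated
nilpotent, so that almost commuting elements are near commuting ones (`exists_commutator_mem_imp`).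
Finally `Γ` embeds in `Γ ⧸ T × Γ ⧸ N` for deep `N`, and the automorphism of `Γ ⧸ T` is glued with
`α` modulo `N` (`exists_mulAut_of_quotients`). -/

namespace NilpotentCSP

open QuotientGroup
open scoped commutatorElement IsMulCommutative

/-! ### Groups all of whose subgroups are finitely generated -/

/-- Every subgroup is finitely generated. -/
class IsNoetherianGroup (G : Type*) [Group G] : Prop where
  fg : ∀ H : Subgroup G, H.FG

section Noetherian

variable {G Q : Type*} [Group G] [Group Q]

instance [h : IsNoetherianGroup G] (H : Subgroup G) : Group.FG H :=
  (Group.fg_iff_subgroup_fg H).2 (h.fg H)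

theorem IsNoetherianGroup.of_injective [h : IsNoetherianGroup Q] (f : G →* Q)
    (hf : Function.Injective f) : IsNoetherianGroup G := by
  refine ⟨fun H => (Group.fg_iff_subgroup_fg H).1 ?_⟩
  exact Group.fg_of_surjective (f := (H.equivMapOfInjective f hf).symm.toMonoidHom)
    (H.equivMapOfInjective f hf).symm.surjective

theorem IsNoetherianGroup.of_surjective [h : IsNoetherianGroup G] (f : G →* Q)
    (hf : Function.Surjective f) : IsNoetherianGroup Q := by
  refine ⟨fun H => (Group.fg_iff_subgroup_fg H).1 ?_⟩
  rw [← Subgroup.map_comap_eq_self_of_surjective hf H]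
  exact Group.fg_of_surjective (f := f.subgroupMap (H.comap f)) (f.subgroupMap_surjective _)

instance [IsNoetherianGroup G] (H : Subgroup G) : IsNoetherianGroup H :=
  .of_injective H.subtype H.subtype_injective

instance [IsNoetherianGroup G] (H : Subgroup G) [H.Normal] : IsNoetherianGroup (G ⧸ H) :=
  .of_surjective (mk' H) (mk'_surjective H)

/-- Lifts of generators of `H.map f`, together with generators of `H ∩ ker f`, generate `H`. -/
theorem IsNoetherianGroup.of_ker [IsNoetherianGroup Q] (f : G →* Q)
    (hk : IsNoetherianGroup f.ker) : IsNoetherianGroup G := by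
  refine ⟨fun H => ?_⟩
  obtain ⟨S, hS⟩ := IsNoetherianGroup.fg (H.map f)
  obtain ⟨T, hT⟩ := IsNoetherianGroup.fg (H.subgroupOf f.ker)
  have hS' : ∀ s : S, ∃ x ∈ H, f x = s := fun s => by
    have : (s : Q) ∈ H.map f := hS ▸ Subgroup.subset_closure s.2
    exact this
  choose g hgH hg using hS'
  rw [Subgroup.fg_iff]
  refine ⟨Set.range g ∪ Subtype.val '' (T : Set f.ker), le_antisymm ?_ ?_,
    (Set.finite_range g).union (T.finite_toSet.image _)⟩
  · rw [Subgroup.closure_le]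
    rintro _ (⟨s, rfl⟩ | ⟨t, ht, rfl⟩)
    · exact hgH s
    · have : t ∈ H.subgroupOf f.ker := hT ▸ Subgroup.subset_closure ht
      exact this
  · set L := Subgroup.closure (Set.range g ∪ Subtype.val '' (T : Set f.ker)) with hL
    have h1 : H.map f ≤ L.map f := by
      rw [← hS, Subgroup.closure_le]
      intro s hs
      exact ⟨g ⟨s, hs⟩, Subgroup.subset_closure (Or.inl ⟨_, rfl⟩), hg ⟨s, hs⟩⟩
    have h2 : H.subgroupOf f.ker ≤ L.subgroupOf f.ker := by
      rw [← hT, Subgroup.closure_le]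
      intro s hs
      exact Subgroup.subset_closure (Or.inr ⟨s, hs, rfl⟩)
    have hLH : L ≤ H := by
      rw [hL, Subgroup.closure_le]
      rintro _ (⟨s, rfl⟩ | ⟨t, ht, rfl⟩)
      · exact hgH s
      · have : t ∈ H.subgroupOf f.ker := hT ▸ Subgroup.subset_closure ht
        exact this
    intro x hx
    obtain ⟨y, hy, hxy⟩ := h1 ⟨x, hx, rfl⟩
    have hk : y⁻¹ * x ∈ f.ker := by simp [MonoidHom.mem_ker, hxy]
    have := @h2 ⟨y⁻¹ * x, hk⟩ (H.mul_mem (H.inv_mem (hLH hy)) hx)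
    have h3 := L.mul_mem hy this
    simpa using h3

instance (priority := 100) [Finite G] : IsNoetherianGroup G :=
  ⟨fun H => (Group.fg_iff_subgroup_fg H).1 inferInstance⟩

theorem IsNoetherianGroup.of_commGroup (A : Type*) [CommGroup A] [Group.FG A] :
    IsNoetherianGroup A := by
  refine ⟨fun H => ?_⟩
  have : Module.Finite ℤ (Additive A) := Module.Finite.iff_addGroup_fg.2 inferInstance
  have hn : IsNoetherian ℤ (Additive A) := inferInstance
  have h1 := hn.noetherian (AddSubgroup.toIntSubmodule (Subgroup.toAddSubgroup H))
  rw [Subgroup.fg_iff_add_fg]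
  rwa [Submodule.fg_iff_addSubgroup_fg] at h1

theorem IsNoetherianGroup.of_comm [Group.FG G] (h : ∀ a b : G, a * b = b * a) :
    IsNoetherianGroup G := by
  let _ : CommGroup G := { (inferInstance : Group G) with mul_comm := h }
  exact IsNoetherianGroup.of_commGroup G

end Noetherian

/-! ### Finiteness properties of finitely generated nilpotent groups. -/

section Nilpotent

variable {G : Type u} [Group G]

/-- If `A` is generated by a set `X` modulo `⁅A, G⁆` and `S` generates `G`, then `⁅A, G⁆` is
generated by the `⁅x, s⁆` modulo `⁅⁅A, G⁆, G⁆`. -/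
theorem commutator_le_closure_sup {A : Subgroup G} [A.Normal] {X S : Set G}
    (hS : Subgroup.closure S = ⊤)
    (hXsub : X ⊆ A) (hX : A ≤ Subgroup.closure X ⊔ ⁅A, (⊤ : Subgroup G)⁆) :
    ⁅A, (⊤ : Subgroup G)⁆ ≤ Subgroup.closure (Set.image2 (fun x s => ⁅x, s⁆) X S) ⊔
      ⁅⁅A, (⊤ : Subgroup G)⁆, (⊤ : Subgroup G)⁆ := by
  set B := ⁅A, (⊤ : Subgroup G)⁆ with hB
  set C := ⁅B, (⊤ : Subgroup G)⁆ with hC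
  set Y := Subgroup.closure (Set.image2 (fun x s => ⁅x, s⁆) X S) ⊔ C with hY
  have hXA : ∀ x ∈ A, ∀ g, ⁅x, g⁆ ∈ B := fun x hx g =>
    Subgroup.commutator_mem_commutator hx (Subgroup.mem_top g)
  have hBC : ∀ b ∈ B, ∀ g : G, ⁅b, g⁆ ∈ Y := fun b hb g =>
    (le_sup_right : C ≤ Y) (Subgroup.commutator_mem_commutator hb (Subgroup.mem_top g))
  -- conjugation of an element of `B ∩ Y`
  have hconj : ∀ b ∈ B, b ∈ Y → ∀ g : G, g * b * g⁻¹ ∈ Y := fun b hb hbY g => by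
    have h := Y.mul_mem (Y.inv_mem (hBC b hb g)) hbY
    have e : ⁅b, g⁆⁻¹ * b = g * b * g⁻¹ := by simp only [commutatorElement_def]; group
    rwa [e] at h
  have h1 : ∀ x ∈ X, ∀ g : G, ⁅x, g⁆ ∈ Y := by
    intro x hx g
    have hg : g ∈ Subgroup.closure S := hS ▸ Subgroup.mem_top g
    induction hg using Subgroup.closure_induction with
    | mem s hs => exact (le_sup_left : _ ≤ Y) (Subgroup.subset_closure ⟨x, hx, s, hs, rfl⟩)
    | one => simp
    | mul a b _ _ iha ihb =>
      rw [show ⁅x, a * b⁆ = ⁅x, a⁆ * (a * ⁅x, b⁆ * a⁻¹) by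
        simp only [commutatorElement_def]; group]
      exact Y.mul_mem iha (hconj _ (hXA x (hXsub hx) b) ihb a)
    | inv a _ iha =>
      rw [show ⁅x, a⁻¹⁆ = a⁻¹ * ⁅x, a⁆⁻¹ * a⁻¹⁻¹ by simp only [commutatorElement_def]; group]
      exact hconj _ (B.inv_mem (hXA x (hXsub hx) a)) (Y.inv_mem iha) a⁻¹
  rw [hB, Subgroup.commutator_le]
  intro y hy g _
  have h2 : ∀ z ∈ Subgroup.closure X, z ∈ A ∧ ∀ g : G, ⁅z, g⁆ ∈ Y := by
    intro z hz
    induction hz using Subgroup.closure_induction with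
    | mem s hs => exact ⟨hXsub hs, h1 s hs⟩
    | one => simp
    | mul a b _ _ iha ihb =>
      refine ⟨A.mul_mem iha.1 ihb.1, fun g => ?_⟩
      rw [show ⁅a * b, g⁆ = (a * ⁅b, g⁆ * a⁻¹) * ⁅a, g⁆ by
        simp only [commutatorElement_def]; group]
      exact Y.mul_mem (hconj _ (hXA b ihb.1 g) (ihb.2 g) a) (iha.2 g)
    | inv a _ iha =>
      refine ⟨A.inv_mem iha.1, fun g => ?_⟩
      rw [show ⁅a⁻¹, g⁆ = a⁻¹ * ⁅a, g⁆⁻¹ * a⁻¹⁻¹ by simp only [commutatorElement_def]; group]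
      exact hconj _ (B.inv_mem (hXA a iha.1 g)) (Y.inv_mem (iha.2 g)) a⁻¹
  obtain ⟨z, hz, b, hb, rfl⟩ := Subgroup.mem_sup_of_normal_right.1 (hX hy)
  rw [show ⁅z * b, g⁆ = (z * ⁅b, g⁆ * z⁻¹) * ⁅z, g⁆ by
        simp only [commutatorElement_def]; group]
  refine Y.mul_mem ?_ ((h2 z hz).2 g)
  exact (le_sup_right : C ≤ Y) (Subgroup.Normal.conj_mem inferInstance _
    (Subgroup.commutator_mem_commutator hb (Subgroup.mem_top g)) z)

theorem exists_finite_lowerCentralSeries_le [h : Group.FG G] (i : ℕ) :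
    ∃ X : Set G, X.Finite ∧ X ⊆ Subgroup.lowerCentralSeries (⊤ : Subgroup G) i ∧
      Subgroup.lowerCentralSeries (⊤ : Subgroup G) i ≤
        Subgroup.closure X ⊔ Subgroup.lowerCentralSeries (⊤ : Subgroup G) (i + 1) := by
  obtain ⟨S, hS, hfin⟩ := Group.fg_iff.1 h
  induction i with
  | zero => exact ⟨S, hfin, fun _ _ => Subgroup.mem_top _, by simp [hS]⟩
  | succ i ih =>
    obtain ⟨X, hX, hXs, hle⟩ := ih
    refine ⟨_, Set.Finite.image2 _ hX hfin, ?_, commutator_le_closure_sup hS hXs hle⟩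
    rintro _ ⟨x, hx, s, -, rfl⟩
    exact Subgroup.commutator_mem_commutator (hXs hx) (Subgroup.mem_top s)

theorem commute_mk_of_commutator_mem {N : Subgroup G} [N.Normal] {x y : G} (h : ⁅x, y⁆ ∈ N) :
    (x : G ⧸ N) * y = y * x := by
  have h1 := (QuotientGroup.eq_one_iff (N := N) ⁅x, y⁆).2 h
  have h2 : ⁅(x : G ⧸ N), (y : G ⧸ N)⁆ = 1 := h1
  exact commutatorElement_eq_one_iff_mul_comm.1 h2

/-- Linearity of the commutator in its first entry where it is central; it transports torsion along
central series. -/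
theorem commutator_pow_mk {N : Subgroup G} [N.Normal] {x y : G} (h : ∀ g, ⁅⁅x, y⁆, g⁆ ∈ N)
    (k : ℕ) : ((⁅x ^ k, y⁆ : G) : G ⧸ N) = ((⁅x, y⁆ : G) : G ⧸ N) ^ k := by
  have hc : ∀ g : G, ((⁅x, y⁆ : G) : G ⧸ N) * g = g * (⁅x, y⁆ : G) := fun g =>
    commute_mk_of_commutator_mem (h g)
  induction k with
  | zero => simp
  | succ k ihk =>
    rw [pow_succ' x k, show ⁅x * x ^ k, y⁆ = x * ⁅x ^ k, y⁆ * x⁻¹ * ⁅x, y⁆ by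
      simp only [commutatorElement_def]; group, QuotientGroup.mk_mul, QuotientGroup.mk_mul,
      QuotientGroup.mk_mul, ihk, ← ((show Commute _ _ from hc x).pow_left k).eq,
      QuotientGroup.mk_inv, mul_inv_cancel_right, ← pow_succ]

/-- The factors of the lower central series are finitely generated abelian, and the property passes
to extensions. -/
instance (priority := 100) [Group.FG G] [hn : Group.IsNilpotent G] : IsNoetherianGroup G := by
  have key : ∀ i, IsNoetherianGroup (G ⧸ Subgroup.lowerCentralSeries (⊤ : Subgroup G) i) := by
    intro i
    induction i with
    | zero =>
      have : Subsingleton (G ⧸ Subgroup.lowerCentralSeries (⊤ : Subgroup G) 0) :=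
        QuotientGroup.subsingleton_quotient_top
      infer_instance
    | succ i ih =>
      have hle : Subgroup.lowerCentralSeries (⊤ : Subgroup G) (i + 1) ≤
        Subgroup.lowerCentralSeries (⊤ : Subgroup G) i :=
        Subgroup.lowerCentralSeries_antitone _ (Nat.le_succ i)
      refine IsNoetherianGroup.of_ker (reduce hle) ?_
      have hmem : ∀ y ∈ (reduce hle).ker, ∃ x ∈ Subgroup.lowerCentralSeries (⊤ : Subgroup G) i,
          (x : G ⧸ Subgroup.lowerCentralSeries (⊤ : Subgroup G) (i + 1)) = y := by
        intro y hy
        obtain ⟨x, rfl⟩ := QuotientGroup.mk_surjective y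
        exact ⟨x, (QuotientGroup.eq_one_iff x).1 hy, rfl⟩
      obtain ⟨X, hX, hXs, hXle⟩ := exists_finite_lowerCentralSeries_le (G := G) i
      have hfg : Group.FG (reduce hle).ker := by
        rw [Group.fg_iff_subgroup_fg, Subgroup.fg_iff]
        refine ⟨(QuotientGroup.mk' _) '' X, ?_, hX.image _⟩
        rw [← MonoidHom.map_closure]
        apply le_antisymm
        · rintro _ ⟨x, hx, rfl⟩
          exact (QuotientGroup.eq_one_iff x).2 ((Subgroup.closure_le _).2 hXs hx)
        · intro y hy
          obtain ⟨x, hx, rfl⟩ := hmem y hy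
          obtain ⟨z, hz, b, hb, rfl⟩ := Subgroup.mem_sup_of_normal_right.1 (hXle hx)
          refine ⟨z, hz, ?_⟩
          exact (QuotientGroup.eq.2 (by simpa using hb))
      refine IsNoetherianGroup.of_comm ?_
      rintro ⟨a, ha⟩ ⟨b, hb⟩
      obtain ⟨x, hx, rfl⟩ := hmem a ha
      obtain ⟨y, hy, rfl⟩ := hmem b hb
      exact Subtype.ext (commute_mk_of_commutator_mem
        (Subgroup.commutator_mem_commutator hx (Subgroup.mem_top y)))
  obtain ⟨n, h0⟩ := Subgroup.nilpotent_iff_lowerCentralSeries.1 hn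
  have := key n
  refine IsNoetherianGroup.of_injective
    (QuotientGroup.mk' (Subgroup.lowerCentralSeries (⊤ : Subgroup G) n)) ?_
  rw [← MonoidHom.ker_eq_bot_iff, QuotientGroup.ker_mk', h0]

theorem finite_of_torsion [Group.FG G] [hn : Group.IsNilpotent G]
    (h : ∀ x : G, ∃ n > 0, x ^ n = 1) : Finite G := by
  have key : ∀ (G : Type u) [Group G] [Group.IsNilpotent G],
      Group.FG G → (∀ x : G, ∃ n > 0, x ^ n = 1) → Finite G := by
    intro G _ _
    refine Group.nilpotent_center_quotient_ind (P := fun G _ _ =>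
      Group.FG G → (∀ x : G, ∃ n > 0, x ^ n = 1) → Finite G) G ?_ ?_
    · intros
      infer_instance
    · intro G _ _ ih hfg h
      have h1 : Finite (G ⧸ Subgroup.center G) := by
        refine ih inferInstance fun x => ?_
        obtain ⟨x, rfl⟩ := QuotientGroup.mk_surjective x
        obtain ⟨n, hn, hx⟩ := h x
        exact ⟨n, hn, by rw [← QuotientGroup.mk_pow, hx]; rfl⟩
      have h2 : Finite (Subgroup.center G) := by
        refine CommGroup.finite_of_fg_isMulTorsion _ fun x => ?_
        obtain ⟨n, hn, hx⟩ := h x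
        exact isOfFinOrder_iff_pow_eq_one.2 ⟨n, hn, Subtype.ext hx⟩
      exact Finite.of_equiv _
        (Subgroup.groupEquivQuotientProdSubgroup (s := Subgroup.center G)).symm
  exact key G inferInstance h

/-- Since `⁅x ^ m, y⁆ ≡ ⁅x, y⁆ ^ m`, the `m`-th power moves each term of the upper central series
into the one below, so `m ^ c` kills `G`. -/
theorem exists_pow_of_center [hn : Group.IsNilpotent G] {m : ℕ} (hm : 0 < m)
    (h : ∀ z ∈ Subgroup.center G, z ^ m = 1) (x : G) : ∃ n > 0, x ^ n = 1 := by
  have key : ∀ i, ∀ x ∈ Subgroup.upperCentralSeries G (i + 1),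
      x ^ m ∈ Subgroup.upperCentralSeries G i := by
    intro i
    induction i with
    | zero =>
      intro x hx
      rw [zero_add, Subgroup.upperCentralSeries_one] at hx
      rw [Subgroup.upperCentralSeries_zero]
      exact h x hx
    | succ i ih =>
      intro x hx
      rw [Subgroup.mem_upperCentralSeries_succ_iff] at hx ⊢
      intro y
      have h1 : ⁅x, y⁆ ^ m ∈ Subgroup.upperCentralSeries G i := ih _ (hx y)
      rw [← QuotientGroup.eq_one_iff] at h1 ⊢
      rw [commutator_pow_mk fun g => (Subgroup.mem_upperCentralSeries_succ_iff).1 (hx y) g,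
        ← QuotientGroup.mk_pow]
      exact h1
  obtain ⟨c, hc⟩ := hn.nilpotent'
  have key2 : ∀ i ≤ c, x ^ m ^ i ∈ Subgroup.upperCentralSeries G (c - i) := by
    intro i
    induction i with
    | zero => intro _; rw [Nat.sub_zero, hc]; trivial
    | succ i ih =>
      intro hi
      rw [pow_succ, pow_mul]
      apply key
      rw [show c - (i + 1) + 1 = c - i by omega]
      exact ih (by omega)
  have := key2 c le_rfl
  rw [Nat.sub_self, Subgroup.upperCentralSeries_zero] at this
  exact ⟨m ^ c, pow_pos hm c, this⟩

end Nilpotent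

theorem finiteIndex_comap {G Q : Type*} [Group G] [Group Q] (f : G →* Q) (W : Subgroup Q)
    [W.FiniteIndex] : (W.comap f).FiniteIndex := by
  constructor
  rw [Subgroup.index_comap]
  exact (inferInstance : (W.subgroupOf f.range).FiniteIndex).index_ne_zero

/-! ### Residual finiteness and its consequences for torsion modulo a normal subgroup. -/

section ResiduallyFinite

variable {G : Type u} [Group G]

/-- Finitely generated nilpotent groups are residually finite. -/
theorem exists_normal_finiteIndex_notMem [Group.FG G] [Group.IsNilpotent G] {x : G} (hx : x ≠ 1) :
    ∃ N : Subgroup G, N.Normal ∧ N.FiniteIndex ∧ x ∉ N := by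
  -- `N` is maximal among normal subgroups avoiding `x`. It remains to see that `G ⧸ N` is finite,
  -- which is done through its centre.
  obtain ⟨N, -, hN⟩ := zorn_le_nonempty₀ {N : Subgroup G | N.Normal ∧ x ∉ N} (by
    intro c hc hchain N0 hN0
    refine ⟨sSup c, ⟨⟨fun n hn g => ?_⟩, fun h => ?_⟩, fun z hz => le_sSup hz⟩
    · rw [Subgroup.mem_sSup_of_directedOn ⟨N0, hN0⟩ hchain.directedOn] at hn ⊢
      obtain ⟨K, hK, hnK⟩ := hn
      exact ⟨K, hK, (hc hK).1.conj_mem n hnK g⟩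
    · rw [Subgroup.mem_sSup_of_directedOn ⟨N0, hN0⟩ hchain.directedOn] at h
      obtain ⟨K, hK, hnK⟩ := h
      exact (hc hK).2 hnK) ⊥ ⟨inferInstance, by simpa using hx⟩
  obtain ⟨hnorm, hxN⟩ := hN.prop
  refine ⟨N, hnorm, ?_, hxN⟩
  -- every nontrivial normal subgroup of the quotient contains the image of `x`
  have hmin : ∀ K : Subgroup (G ⧸ N), K.Normal → K ≠ ⊥ → (x : G ⧸ N) ∈ K := by
    intro K hK hne
    by_contra hxK
    have hle : N ≤ K.comap (mk' N) := fun n hn => by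
      change (n : G ⧸ N) ∈ K
      rw [(QuotientGroup.eq_one_iff n).2 hn]
      exact K.one_mem
    have h2 : K.comap (mk' N) ≤ N := hN.le_of_ge ⟨inferInstance, hxK⟩ hle
    apply hne
    rw [eq_bot_iff]
    intro y hy
    obtain ⟨y, rfl⟩ := QuotientGroup.mk_surjective y
    exact (QuotientGroup.eq_one_iff y).2 (h2 hy)
  have hx1 : (x : G ⧸ N) ≠ 1 := fun h => hxN ((QuotientGroup.eq_one_iff x).1 h)
  have hcen : ∀ z ∈ Subgroup.center (G ⧸ N), z ≠ 1 → (x : G ⧸ N) ∈ Subgroup.zpowers z := by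
    intro z hz hz1
    refine hmin _ ⟨fun y hy g => ?_⟩ (by simpa using hz1)
    have hyc : y ∈ Subgroup.center (G ⧸ N) := (Subgroup.zpowers_le.2 hz) hy
    rw [Subgroup.mem_center_iff.1 hyc g, mul_inv_cancel_right]
    exact hy
  have hxfin : IsOfFinOrder (x : G ⧸ N) := by
    by_cases hbot : Subgroup.center (G ⧸ N) = ⊥
    · have : Subsingleton (G ⧸ N) := by
        by_contra hns
        rw [not_subsingleton_iff_nontrivial] at hns
        exact Group.IsNilpotent.center_ne_bot (G := G ⧸ N) hbot
      exact (hx1 (Subsingleton.elim _ _)).elim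
    · have hxc := hmin _ inferInstance hbot
      by_cases h2 : (x : G ⧸ N) ^ 2 = 1
      · exact isOfFinOrder_iff_pow_eq_one.2 ⟨2, by norm_num, h2⟩
      -- The central subgroup generated by `x ^ 2` contains `x`, so `x ^ (2 * k - 1) = 1`, with odd
      -- and hence nonzero exponent.
      · obtain ⟨k, hk⟩ := Subgroup.mem_zpowers_iff.1 (hcen _ (Subgroup.pow_mem _ hxc 2) h2)
        rw [isOfFinOrder_iff_zpow_eq_one]
        refine ⟨2 * k - 1, by omega, ?_⟩
        rw [zpow_sub, zpow_mul, zpow_one]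
        have : (x : G ⧸ N) ^ (2 : ℤ) = x ^ 2 := by norm_cast
        rw [this, hk, mul_inv_cancel]
  have hfinc : Finite (Subgroup.center (G ⧸ N)) := by
    refine CommGroup.finite_of_fg_isMulTorsion _ fun z => ?_
    by_cases hz : (z : G ⧸ N) = 1
    · exact isOfFinOrder_iff_pow_eq_one.2 ⟨1, one_pos, by ext; simpa using hz⟩
    obtain ⟨k, hk⟩ := Subgroup.mem_zpowers_iff.1 (hcen z z.2 hz)
    obtain ⟨n, hn, hxn⟩ := isOfFinOrder_iff_pow_eq_one.1 hxfin
    have hk0 : k ≠ 0 := by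
      rintro rfl
      exact hx1 (by simpa using hk.symm)
    rw [isOfFinOrder_iff_zpow_eq_one]
    refine ⟨k * n, mul_ne_zero hk0 (by exact_mod_cast hn.ne'), ?_⟩
    ext
    push_cast
    rw [zpow_mul, hk]
    exact_mod_cast hxn
  have hfin : Finite (G ⧸ N) := by
    refine finite_of_torsion (exists_pow_of_center
      (m := Nat.card (Subgroup.center (G ⧸ N))) Nat.card_pos fun z hz => ?_)
    have := pow_card_eq_one' (x := (⟨z, hz⟩ : Subgroup.center (G ⧸ N)))
    exact congrArg Subtype.val this
  exact Subgroup.finiteIndex_of_finite_quotient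

theorem finite_map_of_pow_mem [Group.FG G] [Group.IsNilpotent G] {L B : Subgroup G} [B.Normal]
    (h : ∀ x ∈ L, ∃ m > 0, x ^ m ∈ B) : Finite (L.map (mk' B)) := by
  refine finite_of_torsion ?_
  rintro ⟨_, x, hx, rfl⟩
  obtain ⟨m, hm, hxm⟩ := h x hx
  refine ⟨m, hm, Subtype.ext ?_⟩
  exact (QuotientGroup.eq_one_iff (x ^ m)).2 hxm

/-- The image of `L` in `G ⧸ B` is finite, so residual finiteness of `G ⧸ B` separates all its
nontrivial elements from `1` at once. Taking for `B` the `m`-th powers in a central `L` turns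
closeness to `1` into divisibility. -/
theorem exists_inf_le_of_pow [Group.FG G] [Group.IsNilpotent G] {L B : Subgroup G} [B.Normal]
    (h : ∀ x ∈ L, ∃ m > 0, x ^ m ∈ B) :
    ∃ W : Subgroup G, W.Normal ∧ W.FiniteIndex ∧ W ⊓ L ≤ B := by
  have hfin := finite_map_of_pow_mem h
  have key : ∀ q : L.map (mk' B), ∃ W : Subgroup (G ⧸ B), W.Normal ∧ W.FiniteIndex ∧
      ((q : G ⧸ B) ∈ W → (q : G ⧸ B) = 1) := by
    intro q
    by_cases hq : (q : G ⧸ B) = 1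
    · exact ⟨⊤, inferInstance, inferInstance, fun _ => hq⟩
    · obtain ⟨W, h1, h2, h3⟩ := exists_normal_finiteIndex_notMem hq
      exact ⟨W, h1, h2, fun h => (h3 h).elim⟩
  choose W hW1 hW2 hW3 using key
  refine ⟨(⨅ q, W q).comap (mk' B), (Subgroup.normal_iInf_normal hW1).comap _, ?_, ?_⟩
  · have := Subgroup.finiteIndex_iInf hW2
    exact finiteIndex_comap _ _
  · rintro x ⟨hx, hxL⟩
    exact (QuotientGroup.eq_one_iff x).1
      (hW3 ⟨_, x, hxL, rfl⟩ (Subgroup.mem_iInf.1 hx _))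

theorem exists_pow_mem_of_pow_mem [Group.FG G] [Group.IsNilpotent G] {L B : Subgroup G} [B.Normal]
    (h : ∀ x ∈ L, ∃ m > 0, x ^ m ∈ B) : ∃ m > 0, ∀ x ∈ L, x ^ m ∈ B := by
  have hfin := finite_map_of_pow_mem h
  refine ⟨Nat.card (L.map (mk' B)), Nat.card_pos, fun x hx => ?_⟩
  have := pow_card_eq_one' (x := (⟨_, x, hx, rfl⟩ : L.map (mk' B)))
  exact (QuotientGroup.eq_one_iff (x ^ _)).1 (congrArg Subtype.val this)

theorem exists_characteristic_le [Group.FG G] (M : Subgroup G) [M.Normal] [M.FiniteIndex] :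
    ∃ M' : Subgroup G, M'.Characteristic ∧ M'.FiniteIndex ∧ M' ≤ M :=
  ⟨(charCore ⟨M, inferInstance, inferInstance⟩).toSubgroup, inferInstance,
    (charCore ⟨M, inferInstance, inferInstance⟩).isFiniteIndex', charCore_le _⟩

end ResiduallyFinite

/-- A homomorphism `h` to a finitely generated abelian group: elements of the source whose image is
divisible enough lie in `W * ker h`. -/
theorem exists_pow_imp_mem_mul_ker {S A : Type*} [Group S] [CommGroup A] [Group.FG A] (h : S →* A)
    (W : Subgroup S) [W.FiniteIndex] :
    ∃ m > 0, ∀ u : S, (∃ a : A, a ^ m = h u) → ∃ w ∈ W, ∃ k ∈ h.ker, u = w * k := by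
  have : IsNoetherianGroup A := .of_commGroup A
  let B := W.map h
  have hfin : Finite (CommGroup.torsion (A ⧸ B)) := by
    have : IsNoetherianGroup (A ⧸ B) := inferInstance
    refine CommGroup.finite_of_fg_isMulTorsion _ fun z => ?_
    obtain ⟨n, hn, hz⟩ := isOfFinOrder_iff_pow_eq_one.1 z.2
    exact isOfFinOrder_iff_pow_eq_one.2 ⟨n, hn, Subtype.ext hz⟩
  -- If `a ^ m = h u`, then `a` is torsion modulo `B = h(W)`, because a power of `u` lies in `W`.
  -- With this `m`, therefore, `h u = a ^ m` lies in `h(W)`.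
  refine ⟨Nat.card (CommGroup.torsion (A ⧸ B)), Nat.card_pos, ?_⟩
  rintro u ⟨a, ha⟩
  set m := Nat.card (CommGroup.torsion (A ⧸ B)) with hm
  have hmpos : 0 < m := Nat.card_pos
  have hdiv : ∃ n > 0, u ^ n ∈ W := by
    obtain ⟨n, hn, -, hu⟩ := Subgroup.exists_pow_mem_of_index_ne_zero
      (H := W) Subgroup.FiniteIndex.index_ne_zero u
    exact ⟨n, hn, hu⟩
  obtain ⟨n, hn, hun⟩ := hdiv
  have htor : (a : A ⧸ B) ∈ CommGroup.torsion (A ⧸ B) := by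
    refine isOfFinOrder_iff_pow_eq_one.2 ⟨m * n, Nat.mul_pos hmpos hn, ?_⟩
    rw [← QuotientGroup.mk_pow, pow_mul, ha, ← map_pow]
    exact (QuotientGroup.eq_one_iff _).2 ⟨_, hun, rfl⟩
  have h1 := congrArg Subtype.val (pow_card_eq_one' (x := (⟨_, htor⟩ : CommGroup.torsion (A ⧸ B))))
  have h2 : h u ∈ B := by
    rw [← ha]
    exact (QuotientGroup.eq_one_iff _).1 h1
  obtain ⟨w, hw, hwu⟩ := h2
  exact ⟨w, hw, w⁻¹ * u, by simp [MonoidHom.mem_ker, hwu], by group⟩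

/-! ### Central filtrations and their stability groups -/

section Filtration

variable {Γ : Type u} [Group Γ]

/-- A descending central filtration. -/
structure IsCentralFiltration (F : ℕ → Subgroup Γ) : Prop where
  normal : ∀ i, (F i).Normal
  zero : F 0 = ⊤
  succ_le : ∀ i, F (i + 1) ≤ F i
  comm : ∀ i, ∀ x ∈ F i, ∀ g, ⁅x, g⁆ ∈ F (i + 1)

theorem IsCentralFiltration.antitone {F : ℕ → Subgroup Γ} (hF : IsCentralFiltration F) :
    Antitone F := antitone_nat_of_succ_le hF.succ_le

/-- The automorphisms acting trivially on `F i ⧸ F (i + 1)` for all `i`. -/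
def stability {F : ℕ → Subgroup Γ} (hF : IsCentralFiltration F) : Subgroup (MulAut Γ) where
  carrier := {φ | ∀ i, ∀ x ∈ F i, x⁻¹ * φ x ∈ F (i + 1) ∧ x⁻¹ * φ.symm x ∈ F (i + 1)}
  one_mem' i x _ := by
    change x⁻¹ * x ∈ F (i + 1) ∧ x⁻¹ * x ∈ F (i + 1)
    simp
  inv_mem' {φ} h i x hx := ⟨(h i x hx).2, (h i x hx).1⟩
  mul_mem' {φ ψ} hφ hψ i x hx := by
    constructor
    · have h := mul_mem (mul_mem (hφ i x hx).1 (hψ i x hx).1)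
        (hF.succ_le _ (hφ (i + 1) _ (hψ i x hx).1).1)
      convert h using 1
      change x⁻¹ * φ (ψ x) = _
      simp only [map_mul, map_inv]
      group
    · have h := mul_mem (mul_mem (hψ i x hx).2 (hφ i x hx).2)
        (hF.succ_le _ (hψ (i + 1) _ (hφ i x hx).2).2)
      convert h using 1
      change x⁻¹ * ψ.symm (φ.symm x) = _
      simp only [map_mul, map_inv]
      group

theorem IsCentralFiltration.commute_mk {F : ℕ → Subgroup Γ} (hF : IsCentralFiltration F)
    {i : ℕ} {x : Γ} (hx : x ∈ F i) [(F (i + 1)).Normal]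
    (y : Γ ⧸ F (i + 1)) : (x : Γ ⧸ F (i + 1)) * y = y * x := by
  obtain ⟨y, rfl⟩ := QuotientGroup.mk_surjective y
  exact commute_mk_of_commutator_mem (hF.comm i x hx y)

variable {F : ℕ → Subgroup Γ} {hF : IsCentralFiltration F}

theorem stability_apply_mem {φ : MulAut Γ} (hφ : φ ∈ stability hF) {i : ℕ} {x : Γ} (hx : x ∈ F i) :
    φ x ∈ F i := by
  simpa using mul_mem hx (hF.succ_le i (hφ i x hx).1)

variable (hF) {G : Type*} [Group G] (ρ : G →* MulAut Γ) (hρ : ∀ g, ρ g ∈ stability hF)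

/-- The elements of `G` acting trivially modulo `F j`. -/
def actsTrivially (j : ℕ) : Subgroup G where
  carrier := {g | ∀ x, x⁻¹ * ρ g x ∈ F j}
  one_mem' x := by simp
  mul_mem' {g h} hg hh x := by
    have := mul_mem (hg x) (stability_apply_mem (hρ g) (hh x))
    convert this using 1
    simp
  inv_mem' {g} hg x := by
    have := inv_mem (hg ((ρ g⁻¹) x))
    convert this using 1
    simp

/-- The homomorphism records the displacements `s⁻¹ * g s` of finitely many generators, which are
central modulo `F (j + 1)`. It is multiplicative because `g` fixes `F j` modulo `F (j + 1)`. The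
last clause comes from `exists_inf_le_of_pow` for the `m`-th powers in the centre. -/
theorem exists_hom_actsTrivially [hfg : Group.FG Γ] [Group.IsNilpotent Γ] (j : ℕ) :
    ∃ (A : Type u) (_ : CommGroup A) (_ : Group.FG A) (h : actsTrivially hF ρ hρ j →* A),
      (∀ g, h g = 1 ↔ g.1 ∈ actsTrivially hF ρ hρ (j + 1)) ∧
      ∀ m > 0, ∃ M : Subgroup Γ, M.Characteristic ∧ M.FiniteIndex ∧
        ∀ g, (∀ x, x⁻¹ * ρ g.1 x ∈ M) → ∃ a, a ^ m = h g := by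
  obtain ⟨S, hS, hfin⟩ := Group.fg_iff.1 hfg
  have := hfin.to_subtype
  have := hF.normal (j + 1)
  have hcen : ∀ x ∈ F j, (x : Γ ⧸ F (j + 1)) ∈ Subgroup.center (Γ ⧸ F (j + 1)) := fun x hx =>
    Subgroup.mem_center_iff.2 fun y => (hF.commute_mk hx y).symm
  let h : actsTrivially hF ρ hρ j →* (S → Subgroup.center (Γ ⧸ F (j + 1))) :=
    MonoidHom.mk' (fun g s => ⟨((s : Γ)⁻¹ * ρ g.1 s : Γ), hcen _ (g.2 s)⟩) (by
      intro g k
      ext s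
      change (((s : Γ)⁻¹ * ρ (g.1 * k.1) s : Γ) : Γ ⧸ F (j + 1)) =
        (((s : Γ)⁻¹ * ρ g.1 s * ((s : Γ)⁻¹ * ρ k.1 s) : Γ) : Γ ⧸ F (j + 1))
      rw [eq_comm, QuotientGroup.eq]
      convert (hρ g.1 j _ (k.2 s)).1 using 1
      simp only [map_mul, map_inv, MulAut.mul_apply]
      group)
  refine ⟨S → Subgroup.center (Γ ⧸ F (j + 1)), inferInstance, inferInstance, h, ?_, ?_⟩
  · intro g
    have h1 : h g = 1 ↔ ∀ s : S, (s : Γ)⁻¹ * ρ g.1 s ∈ F (j + 1) := by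
      rw [funext_iff]
      refine forall_congr' fun s => ?_
      rw [← QuotientGroup.eq_one_iff]
      exact Subtype.ext_iff
    rw [h1]
    refine ⟨fun hg => ?_, fun hg s => hg s⟩
    have h2 : (mk' (F (j + 1))).comp (ρ g.1).toMonoidHom = mk' (F (j + 1)) :=
      MonoidHom.eq_of_eqOn_dense hS fun s hs => (QuotientGroup.eq.2 (hg ⟨s, hs⟩)).symm
    exact fun x => QuotientGroup.eq.1 (DFunLike.congr_fun h2 x).symm
  · intro m hm
    let B : Subgroup (Γ ⧸ F (j + 1)) :=
      (powMonoidHom m : Subgroup.center (Γ ⧸ F (j + 1)) →* _).range.map (Subgroup.subtype _)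
    have hB : B ≤ Subgroup.center (Γ ⧸ F (j + 1)) := Subgroup.map_subtype_le _
    have hBn : B.Normal := ⟨fun b hb g => by
      rw [Subgroup.mem_center_iff.1 (hB hb) g, mul_inv_cancel_right]
      exact hb⟩
    obtain ⟨W, hW, hWf, hWB⟩ := exists_inf_le_of_pow (L := Subgroup.center (Γ ⧸ F (j + 1)))
      (B := B) fun x hx => ⟨m, hm, _, ⟨⟨x, hx⟩, rfl⟩, rfl⟩
    have := finiteIndex_comap (mk' (F (j + 1))) W
    obtain ⟨M, hM, hMf, hMW⟩ := exists_characteristic_le (W.comap (mk' (F (j + 1))))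
    refine ⟨M, hM, hMf, fun g hg => ?_⟩
    have h1 : ∀ s : S, ∃ z : Subgroup.center (Γ ⧸ F (j + 1)), z ^ m = h g s := by
      intro s
      obtain ⟨_, ⟨z, rfl⟩, hz⟩ := hWB ⟨hMW (hg s), hcen _ (g.2 s)⟩
      exact ⟨z, Subtype.ext hz⟩
    choose a ha using h1
    exact ⟨a, funext ha⟩

/-- The automorphisms of `Γ` in the image of `ρ` which are congruent to the identity modulo `M`. -/
def congruence (M : Subgroup Γ) [M.Characteristic] : Subgroup G :=
  ((autQuotient M).comp ρ).ker

theorem mem_congruence {M : Subgroup Γ} [M.Characteristic] {g : G} :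
    g ∈ congruence ρ M ↔ ∀ x, x⁻¹ * ρ g x ∈ M := by
  have h1 : g ∈ congruence ρ M ↔ autQuotient M (ρ g) = 1 := Iff.rfl
  rw [h1, MulEquiv.ext_iff, (QuotientGroup.mk_surjective (s := M)).forall]
  refine forall_congr' fun x => ?_
  rw [← QuotientGroup.eq, eq_comm]
  rfl

instance (M : Subgroup Γ) [M.Characteristic] [M.FiniteIndex] : (congruence ρ M).FiniteIndex := by
  unfold congruence
  infer_instance

instance (M : Subgroup Γ) [M.Characteristic] : (congruence ρ M).Normal :=
  MonoidHom.normal_ker _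

/-- The congruence subgroup property for groups acting unipotently on a finitely generated
nilpotent group. -/
theorem exists_congruence_le (hF : IsCentralFiltration F)
    (hρ : ∀ g, ρ g ∈ stability hF) [Group.FG Γ] [Group.IsNilpotent Γ] {c : ℕ} (hc : F c = ⊥)
    (W : Subgroup G) [W.FiniteIndex] (hW : ρ.ker ≤ W) :
    ∃ (M : Subgroup Γ) (_ : M.Characteristic), M.FiniteIndex ∧ congruence ρ M ≤ W := by
  -- Descending induction on the level `c - i`: at level `c` only `ker ρ` is left, and at level `0`
  -- the condition of acting trivially is void.
  have key : ∀ i ≤ c, ∀ W : Subgroup G, W.FiniteIndex → ρ.ker ≤ W →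
      ∃ (M : Subgroup Γ) (_ : M.Characteristic), M.FiniteIndex ∧
        congruence ρ M ⊓ actsTrivially hF ρ hρ (c - i) ≤ W := by
    intro i
    induction i with
    | zero =>
      intro _ W _ hW
      refine ⟨⊤, inferInstance, inferInstance, fun g hg => hW ?_⟩
      ext x
      have := hg.2 x
      rw [Nat.sub_zero, hc, Subgroup.mem_bot] at this
      exact (inv_mul_eq_one.1 this).symm
    | succ i ih =>
      intro hi W hWf hW
      obtain ⟨M₁, hM₁, hM₁f, hle⟩ := ih (by omega) W hWf hW
      obtain ⟨A, _, _, h, hker, hpow⟩ := exists_hom_actsTrivially hF ρ hρ (c - (i + 1))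
      -- Using `W ⊓ congruence ρ M₁` instead of `W` keeps the remaining factor `k` congruent to `1`
      -- modulo `M₁`, so that the induction hypothesis applies to it.
      obtain ⟨m, hm, hmW⟩ := exists_pow_imp_mem_mul_ker h
        ((W ⊓ congruence ρ M₁).subgroupOf (actsTrivially hF ρ hρ (c - (i + 1))))
      obtain ⟨M₂, hM₂, hM₂f, hdiv⟩ := hpow m hm
      refine ⟨M₁ ⊓ M₂, inferInstance, inferInstance, ?_⟩
      rintro g ⟨hg, hgj⟩
      have hg := (mem_congruence ρ).1 hg
      obtain ⟨w, hw, k, hk, hwk⟩ := hmW ⟨g, hgj⟩ (hdiv ⟨g, hgj⟩ fun x => (hg x).2)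
      have hgw : g = w.1 * k.1 := congrArg Subtype.val hwk
      have hk1 := (hker k).1 hk
      rw [show c - (i + 1) + 1 = c - i by omega] at hk1
      have hg1 : g ∈ congruence ρ M₁ := (mem_congruence ρ).2 fun x => (hg x).1
      have hw' : w.1 ∈ W ⊓ congruence ρ M₁ := hw
      have hk2 : k.1 ∈ congruence ρ M₁ := by
        rw [hgw] at hg1
        exact (Subgroup.mul_mem_cancel_left _ hw'.2).1 hg1
      rw [hgw]
      exact W.mul_mem hw'.1 (hle ⟨hk2, hk1⟩)
  obtain ⟨M, hM, hMf, hle⟩ := key c le_rfl W inferInstance hW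
  refine ⟨M, hM, hMf, fun g hg => hle ⟨hg, fun x => ?_⟩⟩
  rw [Nat.sub_self, hF.zero]
  trivial

/-- The chain `actsTrivially` ends in the trivial group and its successive quotients embed in
finitely generated abelian groups. -/
theorem isNoetherianGroup_of_stability (hF : IsCentralFiltration F)
    (hρ : ∀ g, ρ g ∈ stability hF) [Group.FG Γ] [Group.IsNilpotent Γ] {c : ℕ} (hc : F c = ⊥)
    (hinj : Function.Injective ρ) : IsNoetherianGroup G := by
  have key : ∀ i ≤ c, IsNoetherianGroup (actsTrivially hF ρ hρ (c - i)) := by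
    intro i
    induction i with
    | zero =>
      intro _
      have : Subsingleton (actsTrivially hF ρ hρ (c - 0)) := by
        refine subsingleton_of_forall_eq 1 fun g => Subtype.ext (hinj ?_)
        ext x
        have : x⁻¹ * ρ g.1 x ∈ F c := g.2 x
        rw [hc, Subgroup.mem_bot] at this
        rw [← inv_mul_eq_one.1 this, OneMemClass.coe_one, map_one, MulAut.one_apply]
      infer_instance
    | succ i ih =>
      intro hi
      have := ih (by omega)
      obtain ⟨A, _, _, h, hker, -⟩ := exists_hom_actsTrivially hF ρ hρ (c - (i + 1))
      have : IsNoetherianGroup A := .of_commGroup A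
      refine IsNoetherianGroup.of_ker h ?_
      refine IsNoetherianGroup.of_injective (Q := actsTrivially hF ρ hρ (c - i))
        (MonoidHom.mk' (fun g => ⟨g.1.1, by
          have := (hker g.1).1 g.2
          rwa [show c - (i + 1) + 1 = c - i by omega] at this⟩) fun _ _ => rfl) ?_
      intro g g' hg
      have h1 := congrArg Subtype.val hg
      exact Subtype.ext (Subtype.ext h1)
  have := key c le_rfl
  refine IsNoetherianGroup.of_injective (Q := actsTrivially hF ρ hρ (c - c))
    (MonoidHom.mk' (fun g => ⟨g, fun x => by rw [Nat.sub_self, hF.zero]; trivial⟩)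
      fun _ _ => rfl) ?_
  intro g g' hg
  have h1 := congrArg Subtype.val hg
  exact h1

end Filtration

/-! ### Stability groups are themselves finitely generated and nilpotent. -/

section Stability

variable {Γ : Type u} [Group Γ] {F : ℕ → Subgroup Γ}

theorem isNilpotent_stability (hF : IsCentralFiltration F) {c : ℕ} (hc : F c = ⊥) :
    Group.IsNilpotent (stability hF) := by
  -- The automorphisms whose displacements lie `n + 1` steps further down the filtration form a
  -- descending central series.
  let H : ℕ → Subgroup (stability hF) := fun n =>
    { carrier := {φ | ∀ i, ∀ x ∈ F i, x⁻¹ * φ.1 x ∈ F (i + n + 1)}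
      one_mem' := fun i x _ => by simp
      inv_mem' := fun {φ} h i x hx => by
        have hy : (φ⁻¹).1 x ∈ F i := stability_apply_mem (φ⁻¹).2 hx
        convert inv_mem (h i _ hy) using 1
        simp
      mul_mem' := fun {φ ψ} hφ hψ i x hx => by
        convert mul_mem (hφ i x hx) (stability_apply_mem φ.2 (hψ i x hx)) using 1
        simp }
  refine (Subgroup.nilpotent_iff_finite_descending_central_series _).2 ⟨c, H, ⟨?_, ?_⟩, ?_⟩
  · exact eq_top_iff.2 fun φ _ i x hx => (φ.2 i x hx).1
  · intro φ n hφ g i x hx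
    obtain ⟨y, rfl⟩ : ∃ y, g.1 (φ.1 y) = x :=
      ⟨φ.1.symm (g.1.symm x), by simp⟩
    have hy : y ∈ F i := by
      have h1 : (g⁻¹).1 (g.1 (φ.1 y)) ∈ F i := stability_apply_mem (g⁻¹).2 hx
      have h2 : (φ⁻¹).1 ((g⁻¹).1 (g.1 (φ.1 y))) ∈ F i := stability_apply_mem (φ⁻¹).2 h1
      simpa using h2
    have hu := hφ i y hy
    have hv := (g.2 i y hy).1
    have hu' := (g.2 _ _ hu).1
    have hv' := hφ _ _ hv
    rw [show i + 1 + n + 1 = i + n + 1 + 1 by omega] at hv'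
    have hcm := hF.comm _ _ (inv_mem hu) (y⁻¹ * g.1 y)⁻¹
    have e : (φ * g * φ⁻¹ * g⁻¹).1 (g.1 (φ.1 y)) = φ.1 (g.1 y) := by
      simp
    change (g.1 (φ.1 y))⁻¹ * (φ * g * φ⁻¹ * g⁻¹).1 (g.1 (φ.1 y)) ∈ F (i + n + 1 + 1)
    rw [e]
    -- With `x = g (φ y)`, `u = y⁻¹ * φ y` and `v = y⁻¹ * g y`, the displacement of `x` is `(u⁻¹ * g
    -- u)⁻¹ * ⁅u⁻¹, v⁻¹⁆ * (v⁻¹ * φ v)`.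
    convert mul_mem (mul_mem (inv_mem hu') hcm) hv' using 1
    simp only [map_mul, map_inv, commutatorElement_def]
    group
  · refine eq_bot_iff.2 fun φ hφ => ?_
    refine Subtype.ext (MulEquiv.ext fun x => ?_)
    have h := hφ 0 x (by rw [hF.zero]; trivial)
    have h1 := hF.antitone (by omega : c ≤ 0 + c + 1) h
    rw [hc, Subgroup.mem_bot] at h1
    exact (inv_mul_eq_one.1 h1).symm

theorem fg_stability [Group.FG Γ] [Group.IsNilpotent Γ] (hF : IsCentralFiltration F) {c : ℕ}
    (hc : F c = ⊥) : Group.FG (stability hF) := by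
  have := isNoetherianGroup_of_stability (stability hF).subtype hF (fun g => g.2) hc
    Subtype.val_injective
  exact ⟨IsNoetherianGroup.fg ⊤⟩

end Stability

/-- In a finitely generated nilpotent group, an element almost commuting with `t` is close to an
element commuting with `t`. -/
theorem exists_commutator_mem_imp {G : Type u} [Group G] [Group.FG G] [Group.IsNilpotent G] (t : G)
    (W : Subgroup G) [W.Normal] [W.FiniteIndex] :
    ∃ W' : Subgroup G, W'.Normal ∧ W'.FiniteIndex ∧
      ∀ x, ⁅x, t⁆ ∈ W' → ∃ d w, Commute d t ∧ w ∈ W ∧ x = d * w := by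
  have key : ∀ (G : Type u) [Group G] [Group.IsNilpotent G], Group.FG G → ∀ (t : G)
      (W : Subgroup G), W.Normal → W.FiniteIndex → ∃ W' : Subgroup G, W'.Normal ∧ W'.FiniteIndex ∧
      ∀ x, ⁅x, t⁆ ∈ W' → ∃ d w, Commute d t ∧ w ∈ W ∧ x = d * w := by
    intro G _ _
    refine Group.nilpotent_center_quotient_ind (P := fun G _ _ => Group.FG G → ∀ (t : G)
      (W : Subgroup G), W.Normal → W.FiniteIndex → ∃ W' : Subgroup G, W'.Normal ∧ W'.FiniteIndex ∧
      ∀ x, ⁅x, t⁆ ∈ W' → ∃ d w, Commute d t ∧ w ∈ W ∧ x = d * w) G ?_ ?_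
    · intro G _ _ _ t W _ _
      exact ⟨⊤, inferInstance, inferInstance, fun x _ =>
        ⟨1, 1, Subsingleton.elim _ _, W.one_mem, Subsingleton.elim _ _⟩⟩
    · intro G _ _ ih _ t W _ _
      -- By induction `x` is close to an element of `D`. On `D` the map `d ↦ ⁅d, t⁆` is a
      -- homomorphism to the centre; a value close to `1` is an `m`-th power there, so
      -- `exists_pow_imp_mem_mul_ker` supplies a nearby element of its kernel.
      let Z := Subgroup.center G
      -- the elements commuting with `t` modulo the centre
      let D : Subgroup G := (Subgroup.centralizer {(t : G ⧸ Z)}).comap (mk' Z)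
      have hD : ∀ d, d ∈ D ↔ ⁅d, t⁆ ∈ Z := by
        intro d
        rw [Subgroup.mem_comap, Subgroup.mem_centralizer_singleton_iff, eq_comm,
          eq_comm, ← commutatorElement_eq_one_iff_mul_comm]
        exact QuotientGroup.eq_one_iff ⁅d, t⁆
      let h : D →* Z := MonoidHom.mk' (fun d => ⟨⁅d.1, t⁆, (hD d.1).1 d.2⟩) (by
        intro d e
        ext
        change ⁅d.1 * e.1, t⁆ = ⁅d.1, t⁆ * ⁅e.1, t⁆
        have h1 := Subgroup.mem_center_iff.1 ((hD e.1).1 e.2) d.1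
        rw [Subgroup.mem_center_iff.1 ((hD e.1).1 e.2) ⁅d.1, t⁆,
          show ⁅d.1 * e.1, t⁆ = d.1 * ⁅e.1, t⁆ * d.1⁻¹ * ⁅d.1, t⁆ by
            simp only [commutatorElement_def]; group, h1, mul_inv_cancel_right])
      obtain ⟨m, hm, hmW⟩ := exists_pow_imp_mem_mul_ker h (W.subgroupOf D)
      let B : Subgroup G := (powMonoidHom m : Z →* Z).range.map Z.subtype
      have hB : B ≤ Z := Subgroup.map_subtype_le _
      have hBn : B.Normal := ⟨fun b hb g => by
        rw [Subgroup.mem_center_iff.1 (hB hb) g, mul_inv_cancel_right]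
        exact hb⟩
      obtain ⟨V, hV, hVf, hVB⟩ := exists_inf_le_of_pow (L := Z)
        (B := B) fun x hx => ⟨m, hm, _, ⟨⟨x, hx⟩, rfl⟩, rfl⟩
      have hmap : ((W ⊓ V).map (mk' Z)).FiniteIndex :=
        ⟨ne_zero_of_dvd_ne_zero Subgroup.FiniteIndex.index_ne_zero
          (Subgroup.index_map_dvd (W ⊓ V) (mk'_surjective Z))⟩
      obtain ⟨W₁, hW₁, hW₁f, hle⟩ := ih inferInstance t ((W ⊓ V).map (mk' Z))
        (Subgroup.Normal.map inferInstance _ (mk'_surjective Z)) hmap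
      have := finiteIndex_comap (mk' Z) W₁
      refine ⟨W₁.comap (mk' Z) ⊓ V, inferInstance, inferInstance, ?_⟩
      rintro x ⟨hx₁, hxV⟩
      obtain ⟨d₀, w₀, hcomm, hw₀, hxd⟩ := hle x hx₁
      obtain ⟨w, hw, rfl⟩ := hw₀
      have hd : x * w⁻¹ ∈ D := by
        rw [Subgroup.mem_comap, Subgroup.mem_centralizer_singleton_iff, map_mul, map_inv,
          show mk' Z x = d₀ * mk' Z w from hxd, mul_inv_cancel_right]
        exact hcomm
      have h2 : ⁅x * w⁻¹, t⁆ ∈ V := by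
        have h1 := (QuotientGroup.eq_one_iff w).2 hw.2
        have h2 : ⁅(x : G ⧸ V), (t : G ⧸ V)⁆ = 1 := (QuotientGroup.eq_one_iff ⁅x, t⁆).2 hxV
        refine (QuotientGroup.eq_one_iff _).1 ?_
        change ⁅(x : G ⧸ V) * (w : G ⧸ V)⁻¹, (t : G ⧸ V)⁆ = 1
        rw [h1, inv_one, mul_one, h2]
      obtain ⟨_, ⟨z, rfl⟩, hz⟩ := hVB ⟨h2, (hD _).1 hd⟩
      obtain ⟨w', hw', k, hk, hwk⟩ := hmW ⟨x * w⁻¹, hd⟩ ⟨z, Subtype.ext hz⟩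
      have h3 : x * w⁻¹ = w'.1 * k.1 := congrArg Subtype.val hwk
      have h4 : Commute k.1 t := commutatorElement_eq_one_iff_commute.1 (congrArg Subtype.val hk)
      refine ⟨k.1, k.1⁻¹ * w'.1 * k.1 * w, h4, W.mul_mem ?_ hw.1, ?_⟩
      · have := (inferInstance : W.Normal).conj_mem w'.1 hw' k.1⁻¹
        simpa using this
      · rw [show x = (x * w⁻¹) * w by group, h3]
        group
  exact key G inferInstance t W inferInstance inferInstance

/-! ### Approximate homomorphisms, and the tools for correcting them to automorphisms. -/

section Approximation

theorem autQuotient_eq_iff {G : Type u} [Group G] {M : Subgroup G} [M.Characteristic]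
    {φ ψ : MulAut G} : autQuotient M φ = autQuotient M ψ ↔ ∀ x, (φ x)⁻¹ * ψ x ∈ M := by
  rw [MulEquiv.ext_iff, (QuotientGroup.mk_surjective (s := M)).forall]
  refine forall_congr' fun x => ?_
  rw [← QuotientGroup.eq]
  rfl

theorem mem_congruence_iff {Γ : Type u} [Group Γ] {G : Type*} [Group G] (ρ : G →* MulAut Γ)
    {M : Subgroup Γ} [M.Characteristic] {g : G} :
    g ∈ congruence ρ M ↔ autQuotient M (ρ g) = 1 := Iff.rfl

/-- A function which is a homomorphism modulo `W`. -/
def IsHomMod {G : Type*} [Group G] (W : Subgroup G) (a : G → G) : Prop :=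
  ∀ x y, (a x * a y)⁻¹ * a (x * y) ∈ W

/-- The homomorphism to `G ⧸ W` given by a homomorphism modulo `W`. -/
def IsHomMod.hom {G : Type*} [Group G] {W : Subgroup G} [W.Normal] {a : G → G}
    (h : IsHomMod W a) : G →* G ⧸ W :=
  MonoidHom.mk' (fun x => (a x : G ⧸ W)) fun x y => (QuotientGroup.eq.2 (h x y)).symm

theorem IsHomMod.hom_apply {G : Type*} [Group G] {W : Subgroup G} [W.Normal] {a : G → G}
    (h : IsHomMod W a) (x : G) : h.hom x = (a x : G ⧸ W) := rfl

theorem IsHomMod.mono {G : Type*} [Group G] {W W' : Subgroup G} (hW : W ≤ W') {a : G → G}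
    (h : IsHomMod W a) : IsHomMod W' a := fun x y => hW (h x y)

/-- Homomorphisms modulo a deep subgroup which respect the filtration are approximated by
automorphisms in the stability group. -/
def HasApproximation {N : Type u} [Group N] {F : ℕ → Subgroup N} (hF : IsCentralFiltration F) :
    Prop :=
  ∀ W : Subgroup N, W.Normal → W.FiniteIndex → ∃ W' : Subgroup N, W'.Normal ∧ W'.FiniteIndex ∧
    W' ≤ W ∧ ∀ a : N → N, IsHomMod W' a → (∀ i, ∀ x ∈ F i, x⁻¹ * a x ∈ F (i + 1) ⊔ W') →
      ∃ φ ∈ stability hF, ∀ x, (φ x)⁻¹ * a x ∈ W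

variable {N : Type u} [Group N]

/-- Every element is uniquely `y * t ^ k` with `y ∈ ker π`, and it is sent to `d y * s ^ k`. The
hypothesis on `d` is the compatibility of this formula with the semidirect product. -/
theorem exists_hom_extend (π : N →* Multiplicative ℤ) {t s : N}
    (ht : π t = Multiplicative.ofAdd 1) (d : MulAut π.ker)
    (hd : d * MulAut.conjNormal t * d⁻¹ = MulAut.conjNormal s) :
    ∃ f : N →* N, (∀ y : π.ker, f y = d y) ∧ f t = s := by
  have hmem : ∀ x, x * t ^ (-(π x).toAdd) ∈ π.ker := by
    intro x
    rw [MonoidHom.mem_ker, map_mul, map_zpow, ht, ← ofAdd_zsmul]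
    simp
  have hpow : ∀ (k : ℤ) (y : π.ker), d (MulAut.conjNormal (t ^ k) y) =
      MulAut.conjNormal (s ^ k) (d y) := by
    intro k y
    have h1 : d * MulAut.conjNormal (t ^ k) * d⁻¹ = MulAut.conjNormal (s ^ k) := by
      rw [map_zpow, map_zpow, ← hd, conj_zpow]
    rw [← h1]
    simp
  let f : N →* N := MonoidHom.mk'
    (fun x => (d ⟨x * t ^ (-(π x).toAdd), hmem x⟩ : N) * s ^ (π x).toAdd) (by
      intro x y
      have e : (⟨x * y * t ^ (-(π (x * y)).toAdd), hmem (x * y)⟩ : π.ker) =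
          ⟨x * t ^ (-(π x).toAdd), hmem x⟩ *
            MulAut.conjNormal (t ^ (π x).toAdd) ⟨y * t ^ (-(π y).toAdd), hmem y⟩ := by
        ext
        simp only [map_mul, toAdd_mul, Subgroup.coe_mul, MulAut.conjNormal_apply]
        group
      rw [e, map_mul d, hpow, map_mul π, toAdd_mul]
      simp only [Subgroup.coe_mul, MulAut.conjNormal_apply]
      group)
  refine ⟨f, fun y => ?_, ?_⟩
  · have hy : π y = 1 := y.2
    change (d ⟨y * t ^ (-(π y).toAdd), hmem y⟩ : N) * s ^ (π y).toAdd = d y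
    simp [hy]
  · change (d ⟨t * t ^ (-(π t).toAdd), hmem t⟩ : N) * s ^ (π t).toAdd = s
    have e : (⟨t * t ^ (-(π t).toAdd), hmem t⟩ : π.ker) = 1 := by
      ext
      simp [ht]
    rw [e, map_one, ht]
    simp

/-- An automorphism of the kernel of a homomorphism to `ℤ` extends by `t ↦ s`. -/
theorem exists_mulAut_extend (π : N →* Multiplicative ℤ) {t s : N}
    (ht : π t = Multiplicative.ofAdd 1) (hs : π s = Multiplicative.ofAdd 1) (d : MulAut π.ker)
    (hd : d * MulAut.conjNormal t * d⁻¹ = MulAut.conjNormal s) :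
    ∃ φ : MulAut N, (∀ y : π.ker, φ y = d y) ∧ φ t = s := by
  obtain ⟨f, hf, hft⟩ := exists_hom_extend π ht d hd
  obtain ⟨g, hg, hgs⟩ := exists_hom_extend π hs d⁻¹ (s := t) (by rw [← hd]; group)
  have hdec : ∀ (r : N), π r = Multiplicative.ofAdd 1 → ∀ x, ∃ (y : π.ker) (k : ℤ),
      x = y * r ^ k := by
    intro r hr x
    refine ⟨⟨x * r ^ (-(π x).toAdd), ?_⟩, (π x).toAdd, by simp⟩
    rw [MonoidHom.mem_ker, map_mul, map_zpow, hr, ← ofAdd_zsmul]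
    simp
  refine ⟨MonoidHom.toMulEquiv f g ?_ ?_, hf, hft⟩
  · ext x
    obtain ⟨y, k, rfl⟩ := hdec t ht x
    simp [hf, hg, hft, hgs]
  · ext x
    obtain ⟨y, k, rfl⟩ := hdec s hs x
    simp [hf, hg, hft, hgs]

theorem IsCentralFiltration.subgroupOf {F : ℕ → Subgroup N} (hF : IsCentralFiltration F)
    (H : Subgroup N) : IsCentralFiltration fun i => (F i).subgroupOf H where
  normal i := by
    have := hF.normal i
    infer_instance
  zero := by rw [hF.zero, Subgroup.top_subgroupOf]
  succ_le i _ hx := hF.succ_le i hx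
  comm i x hx g := hF.comm i x hx g

/-- The action by conjugation on a normal subgroup is unipotent. -/
def conjStability {F : ℕ → Subgroup N} (hF : IsCentralFiltration F) (H : Subgroup N) [H.Normal] :
    N →* stability (hF.subgroupOf H) :=
  (MulAut.conjNormal (H := H)).codRestrict _ fun g i x hx => by
    constructor
    · have := hF.comm i _ (inv_mem hx) g
      convert this using 1
      simp [Subgroup.mem_subgroupOf, commutatorElement_def, mul_assoc]
    · have := hF.comm i _ (inv_mem hx) g⁻¹
      convert this using 1
      simp [Subgroup.mem_subgroupOf, commutatorElement_def, mul_assoc]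

/-- This is the congruence subgroup property for `F 1` acting on `H` by conjugation, applied to the
finite index subgroup generated by the kernel of the action and `W ∩ F 1`. -/
theorem exists_central_correction [Group.FG N] [Group.IsNilpotent N] {F : ℕ → Subgroup N}
    (hF : IsCentralFiltration F) {c : ℕ} (hc : F c = ⊥) (H : Subgroup N) [H.Normal]
    (W : Subgroup N) [W.Normal] [W.FiniteIndex] :
    ∃ (M : Subgroup H) (_ : M.Characteristic), M.FiniteIndex ∧
      ∀ n ∈ F 1, autQuotient M (MulAut.conjNormal n) = 1 →
        ∃ z ∈ F 1, (MulAut.conjNormal z : MulAut H) = 1 ∧ z⁻¹ * n ∈ W := by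
  have hF1 := hF.normal 1
  let ρ : F 1 →* MulAut H := MulAut.conjNormal.comp (F 1).subtype
  have hV : (ρ.ker ⊔ W.subgroupOf (F 1)).FiniteIndex :=
    Subgroup.finiteIndex_of_le (le_sup_right : W.subgroupOf (F 1) ≤ _)
  obtain ⟨M, hM, hMf, hle⟩ := exists_congruence_le ρ (hF.subgroupOf H)
    (fun n => (conjStability hF H n).2) (c := c)
    (by rw [hc, Subgroup.bot_subgroupOf]) (ρ.ker ⊔ W.subgroupOf (F 1)) le_sup_left
  refine ⟨M, hM, hMf, fun n hn h => ?_⟩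
  have h1 : (⟨n, hn⟩ : F 1) ∈ congruence ρ M := h
  obtain ⟨z, hz, w, hw, hzw⟩ := Subgroup.mem_sup_of_normal_left.1 (hle h1)
  refine ⟨z, z.2, hz, ?_⟩
  have h2 : n = z * w := (congrArg Subtype.val hzw).symm
  rw [h2, inv_mul_cancel_left]
  exact hw

/-- In `U ⧸ J` the hypothesis says that `φ` almost commutes with `t`, so `exists_commutator_mem_imp`
gives a nearby element commuting with `t` modulo `J`. -/
theorem exists_conj_eq_mul_of_mem {U : Type u} [Group U] [Group.FG U] [Group.IsNilpotent U]
    (J V : Subgroup U) [J.Normal] [V.Normal] [V.FiniteIndex] (t : U) :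
    ∃ X : Subgroup U, X.FiniteIndex ∧ ∀ φ, ∀ j ∈ J, (t * j * φ)⁻¹ * (φ * t) ∈ X →
      ∃ d, ∃ j' ∈ J, d⁻¹ * φ ∈ V ∧ d * t * d⁻¹ = t * j' := by
  have hVf : (V.map (mk' J)).FiniteIndex :=
    ⟨ne_zero_of_dvd_ne_zero Subgroup.FiniteIndex.index_ne_zero
      (Subgroup.index_map_dvd V (mk'_surjective J))⟩
  have hVn : (V.map (mk' J)).Normal := Subgroup.Normal.map inferInstance _ (mk'_surjective J)
  obtain ⟨X, hX, hXf, hXV⟩ := exists_commutator_mem_imp (t : U ⧸ J)⁻¹ (V.map (mk' J))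
  refine ⟨X.comap (mk' J), finiteIndex_comap _ _, fun φ j hj h => ?_⟩
  have h2 : ((((t * j * φ)⁻¹ * (φ * t) : U)) : U ⧸ J) ∈ X := h
  have hjJ : (j : U ⧸ J) = 1 := (QuotientGroup.eq_one_iff _).2 hj
  have h3 : ⁅(φ : U ⧸ J)⁻¹, (t : U ⧸ J)⁻¹⁆ ∈ X := by
    have e : ((((t * j * φ)⁻¹ * (φ * t) : U)) : U ⧸ J) = ⁅(φ : U ⧸ J)⁻¹, (t : U ⧸ J)⁻¹⁆ := by
      simp only [QuotientGroup.mk_mul, QuotientGroup.mk_inv, hjJ, commutatorElement_def]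
      group
    rwa [e] at h2
  obtain ⟨d₀, _, hcomm, ⟨v, hv, rfl⟩, hφ⟩ := hXV _ h3
  have hd₀ : ((v * φ : U) : U ⧸ J) = d₀⁻¹ := by
    have hv' : (v : U ⧸ J) = d₀⁻¹ * (φ : U ⧸ J)⁻¹ := by
      rw [hφ, inv_mul_cancel_left]
      rfl
    rw [QuotientGroup.mk_mul, hv', inv_mul_cancel_right]
  have hJmem : t⁻¹ * ((v * φ) * t * (v * φ)⁻¹) ∈ J := by
    refine (QuotientGroup.eq_one_iff _).1 ?_
    rw [QuotientGroup.mk_mul, QuotientGroup.mk_mul, QuotientGroup.mk_mul,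
      QuotientGroup.mk_inv _ (v * φ),
      hd₀, QuotientGroup.mk_inv, ((Commute.inv_right_iff.1 hcomm).inv_left).eq]
    group
  refine ⟨v * φ, _, hJmem, ?_, by group⟩
  have h5 := (inferInstance : V.Normal).conj_mem _ (inv_mem hv) φ⁻¹
  convert h5 using 1
  group

/-- The preceding lemma is used with `U` the stability group of `H` and `J` the conjugations by `F
1`; `J` is normal because stability automorphisms preserve `F 1`. The congruence subgroup property
of `U` replaces closeness in `U` by congruence modulo some `M ≤ H`. -/
theorem exists_conj_eq_of_congruent {H : Subgroup N} [H.Normal] [Group.FG N] [Group.IsNilpotent N]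
    {F : ℕ → Subgroup N}
    (hF : IsCentralFiltration F) {c : ℕ} (hc : F c = ⊥) (hF1 : F 1 ≤ H) (t : N)
    (V : Subgroup (stability (hF.subgroupOf H))) [V.Normal] [V.FiniteIndex] :
    ∃ (M : Subgroup H) (_ : M.Characteristic), M.FiniteIndex ∧
      ∀ φ : stability (hF.subgroupOf H), ∀ n ∈ F 1,
        autQuotient M (φ.1 * MulAut.conjNormal t) =
          autQuotient M (MulAut.conjNormal t * MulAut.conjNormal n * φ.1) →
        ∃ d : stability (hF.subgroupOf H), ∃ n' ∈ F 1, d⁻¹ * φ ∈ V ∧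
          d.1 * MulAut.conjNormal t * d.1⁻¹ = MulAut.conjNormal (t * n') := by
  have hn1 := hF.normal 1
  have hc' : (F c).subgroupOf H = ⊥ := by rw [hc, Subgroup.bot_subgroupOf]
  have : Group.FG (stability (hF.subgroupOf H)) := fg_stability (hF.subgroupOf H) hc'
  have : Group.IsNilpotent (stability (hF.subgroupOf H)) :=
    isNilpotent_stability (hF.subgroupOf H) hc'
  let conj := conjStability hF H
  have hJ : ((F 1).map conj).Normal := by
    refine ⟨?_⟩
    rintro _ ⟨n, hn, rfl⟩ g
    have h1 : (g.1 ⟨n, hF1 hn⟩ : N) ∈ F 1 :=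
      stability_apply_mem (i := 1) g.2 (x := (⟨n, hF1 hn⟩ : H)) hn
    refine ⟨_, h1, ?_⟩
    ext y
    change (g.1 ⟨n, hF1 hn⟩ : N) * y * (g.1 ⟨n, hF1 hn⟩ : N)⁻¹ =
      g.1 (MulAut.conjNormal n (g.1.symm y))
    have e : MulAut.conjNormal n (g.1.symm y) = ⟨n, hF1 hn⟩ * g.1.symm y * ⟨n, hF1 hn⟩⁻¹ := by
      ext
      simp
    rw [e]
    simp
  obtain ⟨X, hXf, hX⟩ := exists_conj_eq_mul_of_mem ((F 1).map conj) V (conj t)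
  obtain ⟨M, hM, hMf, hle⟩ := exists_congruence_le (stability (hF.subgroupOf H)).subtype
    (hF.subgroupOf H) (fun g => g.2) hc' X (by
      rw [(MonoidHom.ker_eq_bot_iff _).2 (Subgroup.subtype_injective _)]
      exact bot_le)
  refine ⟨M, hM, hMf, fun φ n hn h => ?_⟩
  have h1 : (conj t * conj n * φ)⁻¹ * (φ * conj t) ∈
      congruence (stability (hF.subgroupOf H)).subtype M := by
    rw [mem_congruence_iff, map_mul, map_inv, map_mul, map_inv, inv_mul_eq_one]
    simp only [map_mul] at h ⊢
    exact h.symm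
  obtain ⟨d, _, ⟨n', hn', rfl⟩, hd, hdt⟩ := hX φ _ ⟨n, hn, rfl⟩ (hle h1)
  refine ⟨d, n', hn', hd, ?_⟩
  rw [map_mul]
  exact congrArg Subtype.val hdt

end Approximation

/-! ### Passing the approximation property from the kernel of a map onto `ℤ` to the whole group. -/

section ApproximationStep

variable {N : Type u} [Group N]

/-- A finite index subgroup of `H` contains `W ∩ H` for some finite index subgroup `W`. -/
theorem exists_subgroupOf_le [Group.FG N] [Group.IsNilpotent N] (H : Subgroup N) [H.Normal]
    (M : Subgroup H) [M.Characteristic] [M.FiniteIndex] :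
    ∃ W : Subgroup N, W.Normal ∧ W.FiniteIndex ∧ W.subgroupOf H ≤ M := by
  obtain ⟨W, hW, hWf, hle⟩ := exists_inf_le_of_pow (L := H) (B := M.map H.subtype) fun x hx =>
    ⟨M.index, Nat.pos_of_ne_zero Subgroup.FiniteIndex.index_ne_zero, _,
      M.pow_index_mem ⟨x, hx⟩, rfl⟩
  refine ⟨W, hW, hWf, fun x hx => ?_⟩
  obtain ⟨y, hy, hyx⟩ := hle ⟨hx, x.2⟩
  rwa [← Subtype.ext hyx]

theorem apply_mem_iff_of_characteristic {G : Type*} [Group G] (M : Subgroup G)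
    [hM : M.Characteristic] (φ : MulAut G) {x : G} : φ x ∈ M ↔ x ∈ M := by
  have := Subgroup.characteristic_iff_comap_eq.1 hM φ
  exact (SetLike.ext_iff.1 this x)

/-- Displacements lie in `F 1 ⊔ W'` and `F 1 ≤ H`, so the values of `a` on `H` can be moved into `H`
without changing them modulo `W'`. -/
theorem IsHomMod.exists_restrict {H W' : Subgroup N} [H.Normal] [W'.Normal] {a : N → N}
    {F : ℕ → Subgroup N} (hF : IsCentralFiltration F) (hF1 : F 1 ≤ H)
    (ha : IsHomMod W' a) (haF : ∀ i, ∀ x ∈ F i, x⁻¹ * a x ∈ F (i + 1) ⊔ W') :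
    ∃ a' : H → H, (∀ x : H, (a' x : N)⁻¹ * a x ∈ W') ∧ IsHomMod (W'.subgroupOf H) a' ∧
      ∀ i, ∀ x ∈ (F i).subgroupOf H, x⁻¹ * a' x ∈ (F (i + 1)).subgroupOf H ⊔ W'.subgroupOf H := by
  have h1 : ∀ x : H, ∃ k : H, (k : N)⁻¹ * a x ∈ W' := by
    intro x
    obtain ⟨k, hk, w, hw, hkw⟩ := Subgroup.mem_sup_of_normal_right.1
      (haF 0 x (by rw [hF.zero]; trivial))
    refine ⟨x * ⟨k, hF1 hk⟩, ?_⟩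
    rw [Subgroup.coe_mul, mul_inv_rev, mul_assoc, ← hkw, inv_mul_cancel_left]
    exact hw
  choose a' ha' using h1
  have hmk : ∀ x : H, ((a' x : N) : N ⧸ W') = a x := fun x => QuotientGroup.eq.2 (ha' x)
  refine ⟨a', ha', fun x y => ?_, fun i x hx => ?_⟩
  · rw [Subgroup.mem_subgroupOf]
    refine (QuotientGroup.eq_one_iff _).1 ?_
    simp only [Subgroup.coe_mul, Subgroup.coe_inv, QuotientGroup.mk_mul, QuotientGroup.mk_inv]
    rw [hmk, hmk, hmk, inv_mul_eq_one, ← ha.hom_apply, ← ha.hom_apply, ← map_mul]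
    rfl
  · obtain ⟨k, hk, w, hw, hkw⟩ := Subgroup.mem_sup_of_normal_right.1 (haF i x hx)
    have hkH : k ∈ H := hF1 (hF.antitone (by omega) hk)
    refine Subgroup.mem_sup_of_normal_right.2
      ⟨⟨k, hkH⟩, hk, ⟨k, hkH⟩⁻¹ * (x⁻¹ * a' x), ?_, by group⟩
    rw [Subgroup.mem_subgroupOf]
    refine (QuotientGroup.eq_one_iff _).1 ?_
    simp only [Subgroup.coe_mul, Subgroup.coe_inv, QuotientGroup.mk_mul, QuotientGroup.mk_inv]
    rw [hmk, ← QuotientGroup.mk_inv, ← QuotientGroup.mk_inv, ← QuotientGroup.mk_mul,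
      ← QuotientGroup.mk_mul, ← hkw, inv_mul_cancel_left]
    exact (QuotientGroup.eq_one_iff _).2 hw

/-- On `ker π` the induction hypothesis approximates `a` by some `φ'`, and `a t ≈ t * n` with `n ∈ F
1`. An extension to `t` needs an exact conjugation identity, which `φ'` satisfies only
approximately. So `φ'` is replaced by a nearby `d` carrying conjugation by `t` to conjugation by `t
* n₁`. A factor `z` centralising `ker π` then brings `t * n₁` close to `t * n` without disturbing
that identity. -/
theorem hasApproximation_of_ker [Group.FG N] [Group.IsNilpotent N] {F : ℕ → Subgroup N}
    (hF : IsCentralFiltration F) {c : ℕ} (hc : F c = ⊥) (π : N →* Multiplicative ℤ)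
    (hπ : Function.Surjective π) (hF1 : F 1 ≤ π.ker)
    (ih : HasApproximation (hF.subgroupOf π.ker)) : HasApproximation hF := by
  intro W _ _
  have hn1 := hF.normal 1
  obtain ⟨t, ht⟩ := hπ (Multiplicative.ofAdd 1)
  -- choice of the depths
  obtain ⟨M₀, hM₀, hM₀f, hcorr⟩ := exists_central_correction hF hc π.ker W
  obtain ⟨M₀', hM₀', hM₀f', hM₀W⟩ := exists_characteristic_le (W.subgroupOf π.ker)
  have hc' : (F c).subgroupOf π.ker = ⊥ := by rw [hc, Subgroup.bot_subgroupOf]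
  obtain ⟨M₁, hM₁, hM₁f, hconj⟩ := exists_conj_eq_of_congruent hF hc hF1 t
    (congruence (stability (hF.subgroupOf π.ker)).subtype (M₀ ⊓ M₀'))
  obtain ⟨W₁, hW₁, hW₁f, hW₁le, happ⟩ := ih (M₁ ⊓ (M₀ ⊓ M₀')) inferInstance inferInstance
  obtain ⟨M₂, hM₂, hM₂f, hM₂W⟩ := exists_characteristic_le W₁
  obtain ⟨W₂, hW₂, hW₂f, hW₂M⟩ := exists_subgroupOf_le π.ker M₂
  refine ⟨W ⊓ W₂, inferInstance, inferInstance, inf_le_left, fun a ha haF => ?_⟩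
  have hdeep : (W ⊓ W₂).subgroupOf π.ker ≤ W₁ := fun x hx => hM₂W (hW₂M hx.2)
  obtain ⟨a', ha'a, ha', ha'F⟩ := ha.exists_restrict hF hF1 haF
  obtain ⟨(φ' : MulAut π.ker), hφ', hφ'a⟩ := happ a' (ha'.mono hdeep) fun i x hx =>
    sup_le_sup_left hdeep _ (ha'F i x hx)
  obtain ⟨n, hn, w, hw, hnw⟩ := Subgroup.mem_sup_of_normal_right.1
    (haF 0 t (by rw [hF.zero]; trivial))
  have hat : a t = t * n * w := by rw [mul_assoc, hnw, mul_inv_cancel_left]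
  have hmk : ∀ x : π.ker, ((a' x : N) : N ⧸ (W ⊓ W₂)) = a x := fun x => QuotientGroup.eq.2 (ha'a x)
  -- the approximation on the kernel almost intertwines conjugation by `t` and by `t * n`
  have hcong : ∀ y : π.ker, ((φ' * MulAut.conjNormal t : MulAut π.ker) y)⁻¹ *
      (MulAut.conjNormal t * MulAut.conjNormal n * φ' : MulAut π.ker) y ∈ M₁ ⊓ (M₀ ⊓ M₀') := by
    intro y
    have h1 : ((φ' (MulAut.conjNormal t y) : π.ker) : π.ker ⧸ (M₁ ⊓ (M₀ ⊓ M₀'))) =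
        a' (MulAut.conjNormal t y) := QuotientGroup.eq.2 (hφ'a _)
    have h2 : ((MulAut.conjNormal t (MulAut.conjNormal n (φ' y)) : π.ker) :
        π.ker ⧸ (M₁ ⊓ (M₀ ⊓ M₀'))) =
        (MulAut.conjNormal t (MulAut.conjNormal n (a' y)) : π.ker) := by
      refine QuotientGroup.eq.2 ?_
      rw [← map_inv, ← map_inv, ← map_mul, ← map_mul, apply_mem_iff_of_characteristic,
        apply_mem_iff_of_characteristic]
      exact hφ'a y
    refine QuotientGroup.eq.1 ?_
    change ((φ' (MulAut.conjNormal t y) : π.ker) : π.ker ⧸ (M₁ ⊓ (M₀ ⊓ M₀'))) =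
      (MulAut.conjNormal t (MulAut.conjNormal n (φ' y)) : π.ker)
    rw [h1, h2]
    refine QuotientGroup.eq.2 (hW₁le (hdeep ?_))
    rw [Subgroup.mem_subgroupOf]
    refine QuotientGroup.eq.1 ?_
    rw [hmk]
    simp only [MulAut.conjNormal_apply, QuotientGroup.mk_mul, QuotientGroup.mk_inv, hmk]
    have hw1 : (w : N ⧸ (W ⊓ W₂)) = 1 := (QuotientGroup.eq_one_iff w).2 hw
    simp only [← ha.hom_apply, map_mul, map_inv]
    simp only [ha.hom_apply, hat, QuotientGroup.mk_mul, hw1]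
    group
  obtain ⟨d, n₁, hn₁, hdφ, hdt⟩ := hconj ⟨φ', hφ'⟩ n hn
    (autQuotient_eq_iff.2 fun y => (hcong y).1)
  have hq1 : autQuotient (M₀ ⊓ M₀') (φ' * MulAut.conjNormal t) =
      autQuotient (M₀ ⊓ M₀') (MulAut.conjNormal t * MulAut.conjNormal n * φ') :=
    autQuotient_eq_iff.2 fun y => (hcong y).2
  have hq2 : autQuotient (M₀ ⊓ M₀') d.1 = autQuotient (M₀ ⊓ M₀') φ' := by
    rw [mem_congruence_iff, map_mul, map_inv, map_mul, map_inv, inv_mul_eq_one] at hdφ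
    exact hdφ
  -- Since `d` and `φ'` agree at this level, so do conjugation by `t * n₁` and by `t * n`.
  have hq3 : autQuotient (M₀ ⊓ M₀') (MulAut.conjNormal (n₁⁻¹ * n)) = 1 := by
    have h1 := congrArg (autQuotient (M₀ ⊓ M₀')) hdt
    simp only [map_mul, map_inv, hq2] at h1 hq1 ⊢
    rw [hq1, mul_inv_cancel_right] at h1
    rw [mul_left_cancel h1, inv_mul_cancel]
  have hq4 : autQuotient M₀ (MulAut.conjNormal (n₁⁻¹ * n)) = 1 := by
    have h1 := autQuotient_eq_iff.1 (hq3.trans (map_one (autQuotient (M₀ ⊓ M₀'))).symm)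
    have h2 : autQuotient M₀ (MulAut.conjNormal (n₁⁻¹ * n)) = autQuotient M₀ 1 :=
      autQuotient_eq_iff.2 fun y => (h1 y).1
    exact h2.trans (map_one _)
  obtain ⟨z, hz, hzc, hzW⟩ := hcorr (n₁⁻¹ * n) (mul_mem (inv_mem hn₁) hn) hq4
  have hs : π (t * n₁ * z) = Multiplicative.ofAdd 1 := by
    rw [map_mul, map_mul, hF1 hn₁, hF1 hz, mul_one, mul_one, ht]
  obtain ⟨φ, hφ, hφt⟩ := exists_mulAut_extend π ht hs d.1 (by rw [map_mul, hzc, mul_one, hdt])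
  have hdec : ∀ x, ∃ (y : π.ker) (k : ℤ), x = y * t ^ k := by
    intro x
    refine ⟨⟨x * t ^ (-(π x).toAdd), ?_⟩, (π x).toAdd, by simp⟩
    rw [MonoidHom.mem_ker, map_mul, map_zpow, ht, ← ofAdd_zsmul]
    simp
  have hφsymm : ∀ y : π.ker, φ.symm y = d.1.symm y := by
    intro y
    rw [MulEquiv.symm_apply_eq, hφ, MulEquiv.apply_symm_apply]
  have hφ1 : (mk' (F 1)).comp φ.toMonoidHom = mk' (F 1) := by
    ext x
    obtain ⟨y, k, rfl⟩ := hdec x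
    have h1 : (mk' (F 1)) (φ y) = mk' (F 1) y := by
      rw [hφ]
      refine (QuotientGroup.eq.2 ?_).symm
      exact (d.2 0 y (show (y : N) ∈ F 0 by
        rw [hF.zero]
        trivial)).1
    have h2 : (mk' (F 1)) (φ t) = mk' (F 1) t := by
      rw [hφt]
      refine QuotientGroup.eq.2 ?_
      convert mul_mem (inv_mem hz) (inv_mem hn₁) using 1
      group
    change (mk' (F 1)) (φ (y * t ^ k)) = mk' (F 1) (y * t ^ k)
    rw [map_mul, map_mul, map_zpow, map_zpow, h1, h2, map_mul, map_zpow]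
  refine ⟨φ, fun i x hx => ?_, ?_⟩
  -- Only `i = 0` involves `t`; for `i > 0` the term `F i` lies in `ker π`, where `φ` is `d`.
  · rcases Nat.eq_zero_or_pos i with rfl | hi
    · constructor
      · exact QuotientGroup.eq.1 (DFunLike.congr_fun hφ1 x).symm
      · have h1 := DFunLike.congr_fun hφ1 (φ.symm x)
        refine QuotientGroup.eq.1 ?_
        change mk' (F 1) (φ (φ.symm x)) = _ at h1
        rwa [MulEquiv.apply_symm_apply] at h1
    · have hxk : x ∈ π.ker := hF1 (hF.antitone hi hx)
      have h1 := d.2 i ⟨x, hxk⟩ hx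
      have h2 := hφ ⟨x, hxk⟩
      have h3 := hφsymm ⟨x, hxk⟩
      dsimp only at h2 h3
      rw [h2, h3]
      exact h1
  · have hWW : W ⊓ W₂ ≤ W := inf_le_left
    have key : (mk' W).comp φ.toMonoidHom = (ha.mono hWW).hom := by
      ext x
      obtain ⟨y, k, rfl⟩ := hdec x
      have h1 : (mk' W) (φ y) = (ha.mono hWW).hom y := by
        rw [hφ]
        have e1 : ((d.1 y : N) : N ⧸ W) = (φ' y : N) :=
          QuotientGroup.eq.2 (hM₀W (autQuotient_eq_iff.1 hq2 y).2)
        have e2 : ((φ' y : N) : N ⧸ W) = (a' y : N) := QuotientGroup.eq.2 (hM₀W (hφ'a y).2.2)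
        have e3 : ((a' y : N) : N ⧸ W) = a y := QuotientGroup.eq.2 (ha'a y).1
        exact e1.trans (e2.trans e3)
      have h2 : (mk' W) (φ t) = (ha.mono hWW).hom t := by
        rw [hφt]
        refine QuotientGroup.eq.2 ?_
        rw [hat]
        convert mul_mem hzW hw.1 using 1
        group
      change (mk' W) (φ (y * t ^ k)) = (ha.mono hWW).hom (y * t ^ k)
      rw [map_mul, map_mul, map_zpow, map_zpow, h1, h2, map_mul, map_zpow]
    exact fun x => QuotientGroup.eq.1 (DFunLike.congr_fun key x)

end ApproximationStep

/-! ### The approximation property for central filtrations with torsion free quotients. -/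

section ApproximationTorsionFree

/-- The successive quotients are torsion free. -/
def IsIsolated {N : Type u} [Group N] (F : ℕ → Subgroup N) : Prop :=
  ∀ i, ∀ x ∈ F i, ∀ n : ℕ, 0 < n → x ^ n ∈ F (i + 1) → x ∈ F (i + 1)

theorem exists_surjective_ker_eq {N : Type u} [Group N] [Group.FG N] (K : Subgroup N) [K.Normal]
    (hcomm : ∀ x y : N, ⁅x, y⁆ ∈ K) (hK : ∀ x : N, ∀ n : ℕ, 0 < n → x ^ n ∈ K → x ∈ K) :
    ∃ (r : ℕ) (π : N →* Multiplicative (Fin r → ℤ)), Function.Surjective π ∧ π.ker = K := by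
  let _ : CommGroup (N ⧸ K) :=
    { (inferInstance : Group (N ⧸ K)) with
      mul_comm := fun a b => by
        obtain ⟨a, rfl⟩ := QuotientGroup.mk_surjective a
        obtain ⟨b, rfl⟩ := QuotientGroup.mk_surjective b
        exact commute_mk_of_commutator_mem (hcomm a b) }
  have : Module.Finite ℤ (Additive (N ⧸ K)) := Module.Finite.iff_addGroup_fg.2 inferInstance
  have : IsMulTorsionFree (N ⧸ K) := by
    rw [isMulTorsionFree_iff_not_isOfFinOrder]
    intro a ha hfin
    obtain ⟨n, hn, han⟩ := isOfFinOrder_iff_pow_eq_one.1 hfin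
    obtain ⟨a, rfl⟩ := QuotientGroup.mk_surjective a
    exact ha ((QuotientGroup.eq_one_iff a).2 (hK a n hn ((QuotientGroup.eq_one_iff (a ^ n)).1 han)))
  let e := (Module.finBasis ℤ (Additive (N ⧸ K))).equivFun
  let f : N ⧸ K →* Multiplicative (Fin (Module.finrank ℤ (Additive (N ⧸ K))) → ℤ) :=
    AddMonoidHom.toMultiplicativeRight e.toAddEquiv.toAddMonoidHom
  have hf : Function.Bijective f := e.bijective
  refine ⟨_, f.comp (mk' K), hf.2.comp (mk'_surjective K), ?_⟩
  ext x
  rw [MonoidHom.mem_ker, MonoidHom.comp_apply, ← map_one f, hf.1.eq_iff]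
  exact QuotientGroup.eq_one_iff x

/-- Induction on the rank `r` of the top quotient. The kernel of one coordinate has the same `F 1`
with quotient `ℤ ^ r` instead of `ℤ ^ (r + 1)`. At rank `0` one has `F 1 = ⊤`, so dropping the first
term shortens the filtration and `ih` applies. -/
theorem hasApproximation_of_surjective {c : ℕ}
    (ih : ∀ (N : Type u) [Group N] [Group.FG N] [Group.IsNilpotent N] (F : ℕ → Subgroup N)
      (hF : IsCentralFiltration F), IsIsolated F → F c = ⊥ → HasApproximation hF) (r : ℕ) :
    ∀ (N : Type u) [Group N] [Group.FG N] [Group.IsNilpotent N] (F : ℕ → Subgroup N)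
      (hF : IsCentralFiltration F), IsIsolated F → F (c + 1) = ⊥ →
      ∀ π : N →* Multiplicative (Fin r → ℤ), Function.Surjective π → π.ker = F 1 →
      HasApproximation hF := by
  induction r with
  | zero =>
    intro N _ _ _ F hF hiso hc π _ hker
    have htop : F 1 = ⊤ := by
      rw [← hker, eq_top_iff]
      exact fun x _ => Subsingleton.elim (α := Fin 0 → ℤ) _ _
    have hG : IsCentralFiltration fun i => F (i + 1) :=
      ⟨fun i => hF.normal _, htop, fun i => hF.succ_le _, fun i => hF.comm _⟩
    intro W _ _
    obtain ⟨W', h1, h2, h3, h4⟩ := ih N _ hG (fun i => hiso _) hc W inferInstance inferInstance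
    refine ⟨W', h1, h2, h3, fun a ha haF => ?_⟩
    obtain ⟨φ, hφ, hφa⟩ := h4 a ha fun i => haF (i + 1)
    refine ⟨φ, fun i x hx => ?_, hφa⟩
    rcases i with _ | i
    · rw [zero_add, htop]
      exact ⟨trivial, trivial⟩
    · exact hφ i x hx
  | succ r ihr =>
    intro N _ _ _ F hF hiso hc π hπ hker
    let π₀ : N →* Multiplicative ℤ :=
      (AddMonoidHom.toMultiplicative (Pi.evalAddMonoidHom (fun _ : Fin (r + 1) => ℤ) 0)).comp π
    let τ : N →* Multiplicative (Fin r → ℤ) :=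
      (AddMonoidHom.toMultiplicative
        (AddMonoidHom.mk' (fun v : Fin (r + 1) → ℤ => Fin.tail v) fun _ _ => rfl)).comp π
    have hle : F 1 ≤ π₀.ker := by
      intro x hx
      rw [← hker, MonoidHom.mem_ker] at hx
      rw [MonoidHom.mem_ker, MonoidHom.comp_apply, hx, map_one]
    refine hasApproximation_of_ker hF hc π₀ (fun k => ?_) hle ?_
    · obtain ⟨x, hx⟩ := hπ (Multiplicative.ofAdd (fun _ => k.toAdd))
      exact ⟨x, by
        change Multiplicative.ofAdd ((π x).toAdd 0) = k
        rw [hx]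
        rfl⟩
    · refine ihr π₀.ker _ (hF.subgroupOf _) (fun i x hx n hn hxn => hiso i x hx n hn hxn)
        (by rw [hc, Subgroup.bot_subgroupOf]) (τ.comp (Subgroup.subtype _)) ?_ ?_
      · intro v
        obtain ⟨x, hx⟩ := hπ (Multiplicative.ofAdd (Fin.cons 0 v.toAdd))
        refine ⟨⟨x, ?_⟩, ?_⟩
        · change Multiplicative.ofAdd ((π x).toAdd 0) = 1
          rw [hx]
          rfl
        · change Multiplicative.ofAdd (Fin.tail (π x).toAdd) = v
          rw [hx]
          rfl
      · ext x
        rw [Subgroup.mem_subgroupOf, ← hker]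
        have hx0 : (π x).toAdd 0 = 0 := x.2
        constructor
        · intro h
          have h1 : Fin.tail (π x).toAdd = 0 := h
          refine funext fun i => ?_
          refine Fin.cases hx0 (fun j => ?_) i
          exact congrFun h1 j
        · intro h
          have h1 : (π x).toAdd = 0 := h
          change Fin.tail (π x).toAdd = 0
          rw [h1]
          rfl

theorem hasApproximation_of_isIsolated (c : ℕ) :
    ∀ (N : Type u) [Group N] [Group.FG N] [Group.IsNilpotent N] (F : ℕ → Subgroup N)
      (hF : IsCentralFiltration F), IsIsolated F → F c = ⊥ → HasApproximation hF := by
  induction c with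
  | zero =>
    intro N _ _ _ F hF _ hc W _ _
    have : Subsingleton N := by
      rw [← Subgroup.subsingleton_iff, ← subsingleton_iff_bot_eq_top, ← hc, hF.zero]
    exact ⟨W, inferInstance, inferInstance, le_rfl, fun a _ _ =>
      ⟨1, one_mem _, fun x => by rw [Subsingleton.elim (_ * _) 1]; exact W.one_mem⟩⟩
  | succ c ih =>
    intro N _ _ _ F hF hiso hc
    have := hF.normal 1
    have htop : ∀ x, x ∈ F 0 := fun x => by rw [hF.zero]; trivial
    obtain ⟨r, π, hπ, hker⟩ := exists_surjective_ker_eq (F 1) (fun x y => hF.comm 0 x (htop x) y)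
      fun x n hn hx => hiso 0 x (htop x) n hn hx
    exact hasApproximation_of_surjective ih r N F hF hiso hc π hπ hker

end ApproximationTorsionFree

/-! ### The isolated lower central filtration -/

section IsolatedFiltration

variable {Γ : Type u} [Group Γ]

/-- The preimage in `A` of the torsion subgroup of the abelian group `A ⧸ ⁅A, Γ⁆`. -/
def isolatedStep (A : Subgroup Γ) [A.Normal] : Subgroup Γ where
  carrier := {x | x ∈ A ∧ ∃ n > 0, x ^ n ∈ ⁅A, (⊤ : Subgroup Γ)⁆}
  one_mem' := ⟨A.one_mem, 1, one_pos, by simp⟩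
  inv_mem' := fun {x} ⟨h, n, hn, hx⟩ => ⟨A.inv_mem h, n, hn, by rw [inv_pow]; exact inv_mem hx⟩
  mul_mem' := fun {x y} ⟨hx, n, hn, hxn⟩ ⟨hy, m, hm, hym⟩ => by
    refine ⟨A.mul_mem hx hy, n * m, Nat.mul_pos hn hm, ?_⟩
    have hcomm : Commute (x : Γ ⧸ ⁅A, (⊤ : Subgroup Γ)⁆) (y : Γ ⧸ ⁅A, (⊤ : Subgroup Γ)⁆) :=
      commute_mk_of_commutator_mem (Subgroup.commutator_mem_commutator hx (Subgroup.mem_top y))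
    have h1 := (QuotientGroup.eq_one_iff _).2 hxn
    have h2 := (QuotientGroup.eq_one_iff _).2 hym
    rw [QuotientGroup.mk_pow] at h1 h2
    rw [← QuotientGroup.eq_one_iff, QuotientGroup.mk_pow, QuotientGroup.mk_mul, hcomm.mul_pow,
      pow_mul, h1, mul_comm n m, pow_mul, h2, one_pow, one_pow, one_mul]

theorem commutator_le_isolatedStep (A : Subgroup Γ) [A.Normal] :
    ⁅A, (⊤ : Subgroup Γ)⁆ ≤ isolatedStep A := fun x hx =>
  ⟨Subgroup.commutator_le_left A ⊤ hx, 1, one_pos, by rwa [pow_one]⟩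

instance isolatedStep_characteristic (A : Subgroup Γ) [hA : A.Characteristic] :
    (isolatedStep A).Characteristic := by
  rw [Subgroup.characteristic_iff_le_comap]
  rintro φ x ⟨hx, n, hn, hxn⟩
  refine ⟨Subgroup.characteristic_iff_le_comap.1 hA φ hx, n, hn, ?_⟩
  change φ x ^ n ∈ _
  rw [← map_pow]
  exact Subgroup.characteristic_iff_le_comap.1
    (inferInstance : (⁅A, (⊤ : Subgroup Γ)⁆).Characteristic) φ hxn

variable (Γ) in
/-- The fastest descending central series with torsion free quotients. -/
def isolatedSeries : ℕ → {A : Subgroup Γ // A.Characteristic}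
  | 0 => ⟨⊤, inferInstance⟩
  | i + 1 =>
    ⟨@isolatedStep Γ _ (isolatedSeries i).1 (@Subgroup.normal_of_characteristic _ _ _
      (isolatedSeries i).2), @isolatedStep_characteristic Γ _ _ (isolatedSeries i).2⟩

variable (Γ) in
/-- The terms of `isolatedSeries`. -/
def isolated (i : ℕ) : Subgroup Γ := (isolatedSeries Γ i).1

instance (i : ℕ) : (isolated Γ i).Characteristic := (isolatedSeries Γ i).2

theorem isCentralFiltration_isolated : IsCentralFiltration (isolated Γ) where
  normal i := Subgroup.normal_of_characteristic (isolated Γ i)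
  zero := rfl
  succ_le _ _ hx := hx.1
  comm i _ hx g := commutator_le_isolatedStep (isolated Γ i)
    (Subgroup.commutator_mem_commutator hx (Subgroup.mem_top g))

theorem isIsolated_isolated : IsIsolated (isolated Γ) := by
  rintro i x hx n hn ⟨-, m, hm, hxm⟩
  exact ⟨hx, n * m, Nat.mul_pos hn hm, by rwa [pow_mul]⟩

theorem exists_pow_mem_of_mem_isolated_succ {i : ℕ} {x : Γ} (hx : x ∈ isolated Γ (i + 1)) :
    ∃ n > 0, x ^ n ∈ ⁅isolated Γ i, (⊤ : Subgroup Γ)⁆ := hx.2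

theorem isolated_one_eq_ker : isolated Γ 1 = (toStar Γ).ker := by
  have key : ∀ x : Γ, Abelianization.of x = 1 ↔ x ∈ ⁅(⊤ : Subgroup Γ), (⊤ : Subgroup Γ)⁆ :=
      fun x => by
    have := Abelianization.ker_of Γ
    rw [← MonoidHom.mem_ker, this]
    rfl
  ext x
  have h1 : x ∈ (toStar Γ).ker ↔ IsOfFinOrder (Abelianization.of x) := by
    rw [MonoidHom.mem_ker]
    exact QuotientGroup.eq_one_iff (Abelianization.of x)
  rw [h1, isOfFinOrder_iff_pow_eq_one]
  constructor
  · rintro ⟨-, n, hn, hx⟩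
    exact ⟨n, hn, by rw [← map_pow, key]; exact hx⟩
  · rintro ⟨n, hn, hx⟩
    exact ⟨trivial, n, hn, by rw [← map_pow, key] at hx; exact hx⟩

/-- The condition passes from `Y` to `⁅Y, Γ⁆`, as `⁅g, k⁆ ^ m ≡ ⁅g ^ m, k⁆` modulo `⁅⁅Y, Γ⁆, Γ⁆`,
while `⁅Y, Γ⁆` lies lower in the upper central series. Induction therefore makes `⁅Y, Γ⁆`, and with
it `Y`, torsion. -/
theorem exists_pow_eq_one_of_pow_mem_commutator [hn : Group.IsNilpotent Γ] (Y : Subgroup Γ)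
    [hY : Y.Normal] (h : Y ≤ isolatedStep Y) : ∀ y ∈ Y, ∃ n > 0, y ^ n = 1 := by
  have key : ∀ j, ∀ (Y : Subgroup Γ) [Y.Normal], Y ≤ isolatedStep Y →
      Y ≤ Subgroup.upperCentralSeries Γ j → ∀ y ∈ Y, ∃ n > 0, y ^ n = 1 := by
    intro j
    induction j with
    | zero =>
      intro Y _ _ hle y hy
      exact ⟨1, one_pos, by simpa using hle hy⟩
    | succ j ih =>
      intro Y _ h hle y hy
      obtain ⟨-, n, hn, hyn⟩ := h hy
      have h1 : ⁅Y, (⊤ : Subgroup Γ)⁆ ≤ Subgroup.upperCentralSeries Γ j := by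
        rw [Subgroup.commutator_le]
        intro g hg k _
        exact Subgroup.mem_upperCentralSeries_succ_iff.1 (hle hg) k
      have h2 : ⁅Y, (⊤ : Subgroup Γ)⁆ ≤ isolatedStep ⁅Y, (⊤ : Subgroup Γ)⁆ := by
        rw [Subgroup.commutator_le]
        intro g hg k _
        obtain ⟨-, m, hm, hgm⟩ := h hg
        have hgk : ⁅g, k⁆ ∈ ⁅Y, (⊤ : Subgroup Γ)⁆ :=
          Subgroup.commutator_mem_commutator hg (Subgroup.mem_top k)
        refine ⟨hgk, m, hm, ?_⟩
        rw [← QuotientGroup.eq_one_iff, QuotientGroup.mk_pow, ← commutator_pow_mk fun l =>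
          Subgroup.commutator_mem_commutator hgk (Subgroup.mem_top l), QuotientGroup.eq_one_iff]
        exact Subgroup.commutator_mem_commutator hgm (Subgroup.mem_top k)
      obtain ⟨m, hm, hym⟩ := ih _ h2 h1 _ hyn
      exact ⟨n * m, Nat.mul_pos hn hm, by rwa [pow_mul]⟩
  obtain ⟨c, hc⟩ := hn.nilpotent'
  exact key c Y h (hc ▸ le_top)

/-- In `Γ ⧸ ⁅A, Γ⁆` the powers `b ^ m ∈ A` become central, so the image of `⁅B, Γ⁆` satisfies the
condition of the preceding lemma and is torsion. -/
theorem exists_pow_mem_commutator_of_pow_mem [Group.IsNilpotent Γ] {A B : Subgroup Γ} [A.Normal]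
    [B.Normal] (h : ∀ b ∈ B, ∃ n > 0, b ^ n ∈ A) {z : Γ} (hz : z ∈ ⁅B, (⊤ : Subgroup Γ)⁆) :
    ∃ n > 0, z ^ n ∈ ⁅A, (⊤ : Subgroup Γ)⁆ := by
  let q := mk' ⁅A, (⊤ : Subgroup Γ)⁆
  have hq : Function.Surjective q := mk'_surjective _
  have hmap : ∀ C : Subgroup Γ, (⁅C, (⊤ : Subgroup Γ)⁆).map q =
      ⁅C.map q, (⊤ : Subgroup (Γ ⧸ ⁅A, (⊤ : Subgroup Γ)⁆))⁆ := fun C => by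
    rw [Subgroup.map_commutator, Subgroup.map_top_of_surjective q hq]
  have hBn : (B.map q).Normal := Subgroup.Normal.map inferInstance q hq
  have hY : ⁅B.map q, (⊤ : Subgroup (Γ ⧸ ⁅A, (⊤ : Subgroup Γ)⁆))⁆ ≤
      isolatedStep ⁅B.map q, (⊤ : Subgroup (Γ ⧸ ⁅A, (⊤ : Subgroup Γ)⁆))⁆ := by
    rw [Subgroup.commutator_le]
    rintro _ ⟨b, hb, rfl⟩ k _
    obtain ⟨k, rfl⟩ := hq k
    obtain ⟨m, hm, hbm⟩ := h b hb
    have hgk : ⁅q b, q k⁆ ∈ ⁅B.map q, (⊤ : Subgroup (Γ ⧸ ⁅A, (⊤ : Subgroup Γ)⁆))⁆ :=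
      Subgroup.commutator_mem_commutator ⟨b, hb, rfl⟩ (Subgroup.mem_top _)
    refine ⟨hgk, m, hm, ?_⟩
    rw [← QuotientGroup.eq_one_iff, QuotientGroup.mk_pow, ← commutator_pow_mk fun l =>
      Subgroup.commutator_mem_commutator hgk (Subgroup.mem_top l), QuotientGroup.eq_one_iff]
    have h1 : ⁅q b ^ m, q k⁆ = 1 := (QuotientGroup.eq_one_iff ⁅b ^ m, k⁆).2
      (Subgroup.commutator_mem_commutator hbm (Subgroup.mem_top k))
    rw [h1]
    exact one_mem _
  have hz' : q z ∈ ⁅B.map q, (⊤ : Subgroup (Γ ⧸ ⁅A, (⊤ : Subgroup Γ)⁆))⁆ := by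
    rw [← hmap]
    exact ⟨z, hz, rfl⟩
  obtain ⟨n, hn, hzn⟩ := exists_pow_eq_one_of_pow_mem_commutator _ hY _ hz'
  exact ⟨n, hn, (QuotientGroup.eq_one_iff (z ^ n)).1 hzn⟩

theorem exists_pow_mem_lowerCentralSeries [Group.IsNilpotent Γ] (i : ℕ) :
    ∀ x ∈ isolated Γ i, ∃ n > 0, x ^ n ∈ Subgroup.lowerCentralSeries (⊤ : Subgroup Γ) i := by
  induction i with
  | zero => exact fun x _ => ⟨1, one_pos, trivial⟩
  | succ i ih =>
    intro x hx
    obtain ⟨n, hn, hxn⟩ := exists_pow_mem_of_mem_isolated_succ hx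
    obtain ⟨m, hm, hxm⟩ := exists_pow_mem_commutator_of_pow_mem ih hxn
    exact ⟨n * m, Nat.mul_pos hn hm, by rw [pow_mul]; exact hxm⟩

/-- The term `isolated Γ c` is already torsion when the lower central series vanishes at `c`. The
index `c + 1` leaves a predecessor for `exists_mulAut_quotient_approximation`. -/
theorem exists_finite_isolated [Group.FG Γ] [hn : Group.IsNilpotent Γ] :
    ∃ c, Finite (isolated Γ (c + 1)) := by
  obtain ⟨c, hc⟩ := Subgroup.nilpotent_iff_lowerCentralSeries.1 hn
  refine ⟨c, finite_of_torsion fun x => ?_⟩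
  obtain ⟨n, hn, hx⟩ := exists_pow_mem_lowerCentralSeries (Γ := Γ) c x x.2.1
  rw [hc, Subgroup.mem_bot] at hx
  exact ⟨n, hn, Subtype.ext hx⟩

end IsolatedFiltration

/-! ### Homomorphisms modulo a deep subgroup respect the isolated filtration -/

section Respect

variable {Γ : Type u} [Group Γ]

/-- The values `⁅k, g⁆` lie in `F (j + 1)`, which is central modulo `F (j + 2)`. This makes the map
multiplicative with commuting values. -/
theorem IsCentralFiltration.exists_commutator_hom {F : ℕ → Subgroup Γ} (hF : IsCentralFiltration F)
    {j : ℕ} {k : Γ} (hk : k ∈ F j) [(F (j + 2)).Normal] :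
    ∃ ψ : Γ →* Γ ⧸ F (j + 2), (∀ g, ψ g = (⁅k, g⁆ : Γ)) ∧
      ⁅(⊤ : Subgroup Γ), (⊤ : Subgroup Γ)⁆ ≤ ψ.ker := by
  have hc : ∀ g (y : Γ ⧸ F (j + 2)),
      ((⁅k, g⁆ : Γ) : Γ ⧸ F (j + 2)) * y = y * (⁅k, g⁆ : Γ) :=
    fun g y => hF.commute_mk (hF.comm j k hk g) y
  refine ⟨MonoidHom.mk' (fun g => ((⁅k, g⁆ : Γ) : Γ ⧸ F (j + 2))) fun g h => ?_, fun _ => rfl, ?_⟩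
  · rw [show ⁅k, g * h⁆ = ⁅k, g⁆ * (g * ⁅k, h⁆ * g⁻¹) by
      simp only [commutatorElement_def]; group, QuotientGroup.mk_mul, QuotientGroup.mk_mul,
      QuotientGroup.mk_mul, ← hc h g, QuotientGroup.mk_inv, mul_inv_cancel_right]
  · rw [Subgroup.commutator_le]
    intro g _ h _
    rw [MonoidHom.mem_ker, map_commutatorElement]
    exact commutatorElement_eq_one_iff_mul_comm.2 (hc g _)

/-- A power of `l` lies in `[Γ, Γ]`, which `⁅k, ·⁆` kills modulo `isolated Γ (j + 2)`; torsion
freeness removes the exponent. -/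
theorem commutator_mem_isolated {j : ℕ} {k l : Γ} (hk : k ∈ isolated Γ j)
    (hl : l ∈ isolated Γ 1) : ⁅k, l⁆ ∈ isolated Γ (j + 2) := by
  have hF := isCentralFiltration_isolated (Γ := Γ)
  obtain ⟨ψ, hψ, hker⟩ := hF.exists_commutator_hom hk
  obtain ⟨-, n, hn, hln⟩ := hl
  refine isIsolated_isolated (j + 1) _ (hF.comm j k hk l) n hn ((QuotientGroup.eq_one_iff _).1 ?_)
  have h1 := hker hln
  rw [MonoidHom.mem_ker, map_pow, hψ] at h1
  exact h1

theorem commutator_mul_mul_of_commute {x u y l : Γ} (h : Commute u (y * l)) (h' : Commute x l) :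
    ⁅x * u, y * l⁆ = ⁅x, y⁆ := by
  simp only [commutatorElement_def]
  calc x * u * (y * l) * (x * u)⁻¹ * (y * l)⁻¹ = x * (u * (y * l)) * u⁻¹ * x⁻¹ * (l⁻¹ * y⁻¹) := by
        group
    _ = x * y * (l * x⁻¹) * (l⁻¹ * y⁻¹) := by rw [h.eq]; group
    _ = x * y * x⁻¹ * y⁻¹ := by rw [← h'.inv_left.eq]; group

variable [Group.FG Γ] [Group.IsNilpotent Γ]

/-- A finite-level form of torsion freeness of `F j ⧸ F (j + 1)`. With `k` the index of `W`, a deep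
`W₁` forces `y ^ n ≡ z ^ (k * n)`; hence `y ≡ z ^ k`, and `z ^ k ∈ W`. -/
theorem exists_pow_mem_sup_imp {F : ℕ → Subgroup Γ} (hF : IsCentralFiltration F)
    (hI : IsIsolated F) (j : ℕ) {n : ℕ} (hn : 0 < n) (W : Subgroup Γ) [W.Normal]
    [W.FiniteIndex] :
    ∃ W₁ : Subgroup Γ, W₁.Normal ∧ W₁.FiniteIndex ∧ W₁ ≤ W ∧
      ∀ y ∈ F j, y ^ n ∈ F (j + 1) ⊔ W₁ → y ∈ F (j + 1) ⊔ W := by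
  have := hF.normal (j + 1)
  have hcomm : ∀ x ∈ F j, ∀ y : Γ ⧸ F (j + 1), Commute (x : Γ ⧸ F (j + 1)) y := fun x hx y =>
    hF.commute_mk hx y
  let k := W.index
  have hk : 0 < k := Nat.pos_of_ne_zero Subgroup.FiniteIndex.index_ne_zero
  let B : Subgroup Γ :=
    { carrier := {x | ∃ z ∈ F j, (x : Γ ⧸ F (j + 1)) = (z : Γ ⧸ F (j + 1)) ^ (k * n)}
      one_mem' := ⟨1, one_mem _, by simp⟩
      inv_mem' := by
        rintro x ⟨z, hz, hx⟩
        exact ⟨z⁻¹, inv_mem hz, by rw [QuotientGroup.mk_inv, hx, QuotientGroup.mk_inv, inv_pow]⟩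
      mul_mem' := by
        rintro x x' ⟨z, hz, hx⟩ ⟨z', hz', hx'⟩
        exact ⟨z * z', mul_mem hz hz', by
          rw [QuotientGroup.mk_mul, hx, hx', QuotientGroup.mk_mul, (hcomm z hz _).mul_pow]⟩ }
  have hB : B.Normal := ⟨by
    rintro x ⟨z, hz, hx⟩ g
    refine ⟨z, hz, ?_⟩
    rw [QuotientGroup.mk_mul, QuotientGroup.mk_mul, hx,
      ← ((hcomm z hz (g : Γ ⧸ F (j + 1))).pow_left _).eq, QuotientGroup.mk_inv,
      mul_inv_cancel_right]⟩
  obtain ⟨V, hV1, hV2, hV⟩ := exists_inf_le_of_pow (L := F j) (B := B) fun x hx =>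
    ⟨k * n, Nat.mul_pos hk hn, x, hx, by rw [QuotientGroup.mk_pow]⟩
  refine ⟨W ⊓ V, inferInstance, inferInstance, inf_le_left, fun y hy hyn => ?_⟩
  obtain ⟨f, hf, w, hw, hfw⟩ := Subgroup.mem_sup_of_normal_left.1 hyn
  have hwj : w ∈ F j := by
    rw [show w = f⁻¹ * y ^ n by rw [← hfw]; group]
    exact mul_mem (inv_mem (hF.succ_le j hf)) (pow_mem hy n)
  obtain ⟨z, hz, hwz⟩ := hV ⟨hw.2, hwj⟩
  have h1 : (y : Γ ⧸ F (j + 1)) ^ n = ((z : Γ ⧸ F (j + 1)) ^ k) ^ n := by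
    rw [← QuotientGroup.mk_pow, ← hfw, QuotientGroup.mk_mul, (QuotientGroup.eq_one_iff f).2 hf,
      one_mul, hwz, pow_mul]
  have h2 : y * (z ^ k)⁻¹ ∈ F (j + 1) := by
    refine hI j _ (mul_mem hy (inv_mem (pow_mem hz k))) n hn ?_
    rw [← QuotientGroup.eq_one_iff, QuotientGroup.mk_pow, QuotientGroup.mk_mul,
      (hcomm y hy _).mul_pow, h1, QuotientGroup.mk_inv, QuotientGroup.mk_pow, inv_pow,
      mul_inv_cancel]
  exact Subgroup.mem_sup_of_normal_left.2
    ⟨_, h2, z ^ k, W.pow_index_mem z, by group⟩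

/-- A homomorphism modulo a deep subgroup which is trivial on `Γ*` acts trivially on the first
successive quotients of the isolated filtration. -/
theorem exists_isHomMod_imp_mem_isolated (j : ℕ) :
    ∀ W : Subgroup Γ, W.Normal → W.FiniteIndex →
      ∃ W' : Subgroup Γ, W'.Normal ∧ W'.FiniteIndex ∧ W' ≤ W ∧
        ∀ a : Γ → Γ, IsHomMod W' a → (∀ x, x⁻¹ * a x ∈ isolated Γ 1 ⊔ W') →
          ∀ i ≤ j, ∀ x ∈ isolated Γ i, x⁻¹ * a x ∈ isolated Γ (i + 1) ⊔ W := by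
  have hF := isCentralFiltration_isolated (Γ := Γ)
  induction j with
  | zero =>
    intro W h1 h2
    refine ⟨W, h1, h2, le_rfl, fun a _ h i hi x _ => ?_⟩
    obtain rfl : i = 0 := by lia
    exact h x
  | succ j ih =>
    intro W h1 h2
    obtain ⟨n, hn, hpow⟩ := exists_pow_mem_of_pow_mem (L := isolated Γ (j + 1))
      (B := ⁅isolated Γ j, (⊤ : Subgroup Γ)⁆) fun x hx => exists_pow_mem_of_mem_isolated_succ hx
    obtain ⟨W₁, hW₁n, hW₁f, hW₁W, hW₁⟩ := exists_pow_mem_sup_imp hF isIsolated_isolated (j + 1) hn W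
    obtain ⟨W', hW'n, hW'f, hW'W, hW'⟩ := ih W₁ hW₁n hW₁f
    refine ⟨W', hW'n, hW'f, hW'W.trans hW₁W, fun a ha h => ?_⟩
    have hi := hW' a ha h
    intro i hij x hx
    rcases hij.lt_or_eq with hij | rfl
    · exact sup_le_sup_left hW₁W _ (hi i (by lia) x hx)
    let Q := isolated Γ (j + 2) ⊔ W₁
    have haQ : IsHomMod Q a := ha.mono (hW'W.trans le_sup_right)
    have hmk : ∀ {i : ℕ} {x : Γ}, x⁻¹ * a x ∈ isolated Γ i ⊔ W₁ → ∃ y ∈ isolated Γ i, ∃ w ∈ W₁,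
        x⁻¹ * a x = y * w ∧ haQ.hom x = (x : Γ ⧸ Q) * (y : Γ ⧸ Q) := by
      intro i x hx
      obtain ⟨y, hy, w, hw, hyw⟩ := Subgroup.mem_sup_of_normal_right.1 hx
      refine ⟨y, hy, w, hw, hyw.symm, ?_⟩
      rw [haQ.hom_apply, show a x = x * y * w by rw [mul_assoc, hyw]; group, QuotientGroup.mk_mul,
        QuotientGroup.mk_mul, (QuotientGroup.eq_one_iff w).2
          (show w ∈ Q from le_sup_right (a := isolated Γ (j + 2)) hw), mul_one]
    have hcomm : ∀ {x y : Γ}, ⁅x, y⁆ ∈ isolated Γ (j + 2) →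
        Commute (x : Γ ⧸ Q) (y : Γ ⧸ Q) := fun h =>
      commute_mk_of_commutator_mem (le_sup_left (b := W₁) h)
    -- The errors `k'` of `k` and `l` of `g` drop out of `⁅k * k', g * l⁆`: modulo `Q`, `k'` is
    -- central and `k` commutes with `l`.
    have hfix : ⁅isolated Γ j, (⊤ : Subgroup Γ)⁆ ≤ haQ.hom.eqLocus (mk' Q) := by
      rw [Subgroup.commutator_le]
      intro k hk g _
      obtain ⟨k', hk', -, -, -, hak⟩ := hmk (hi j le_rfl k hk)
      obtain ⟨l, hl, -, -, -, hag⟩ := hmk (hi 0 (Nat.zero_le _) g trivial)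
      change haQ.hom ⁅k, g⁆ = mk' Q ⁅k, g⁆
      have e1 : Commute (k' : Γ ⧸ Q) ((g : Γ ⧸ Q) * (l : Γ ⧸ Q)) := by
        rw [← QuotientGroup.mk_mul]
        exact hcomm (hF.comm (j + 1) k' hk' _)
      have e2 : Commute (k : Γ ⧸ Q) (l : Γ ⧸ Q) := hcomm (commutator_mem_isolated hk hl)
      rw [map_commutatorElement, map_commutatorElement, hak, hag, mk'_apply, mk'_apply,
        commutator_mul_mul_of_commute e1 e2]
    obtain ⟨y, hy, w, hw, hyw, hax⟩ := hmk (hi j le_rfl x (hF.succ_le j hx))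
    have hxy : Commute (x : Γ ⧸ Q) (y : Γ ⧸ Q) := hcomm (hF.comm (j + 1) x hx y)
    -- As `x ^ n` is a product of commutators fixed by `a`, the error `y` of `x` satisfies `y ^ n ∈
    -- Q`, and `hW₁` extracts the root.
    have h3 : haQ.hom (x ^ n) = mk' Q (x ^ n) := hfix (hpow x hx)
    rw [map_pow, hax, hxy.mul_pow, map_pow, mk'_apply, mul_eq_left, ← QuotientGroup.mk_pow,
      QuotientGroup.eq_one_iff] at h3
    rw [hyw]
    exact mul_mem (hW₁ y hy h3) (le_sup_right (a := isolated Γ (j + 2)) (hW₁W hw))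

end Respect

/-! ### Approximation of automorphisms of the completion -/

section Glue

variable {Γ : Type u} [Group Γ]

/-- An automorphism of `Γ ⧸ T` and a compatible homomorphism `Γ → Γ ⧸ N` with kernel in `N` come
from an automorphism of `Γ`, if `T` is finite and meets `N` trivially. -/
theorem exists_mulAut_of_quotients {T N : Subgroup Γ} [T.Normal] [N.Normal] [Finite T]
    (hTN : ∀ x ∈ T, x ∈ N → x = 1) (φ : MulAut (Γ ⧸ T)) (A : Γ →* Γ ⧸ N)
    (hA : ∀ x, A x = 1 → x ∈ N) (h : ∀ x : Γ, ∃ y : Γ, (y : Γ ⧸ T) = φ x ∧ (y : Γ ⧸ N) = A x) :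
    ∃ ψ : MulAut Γ, ∀ x : Γ, (ψ x : Γ ⧸ T) = φ x ∧ (ψ x : Γ ⧸ N) = A x := by
  -- An element of `Γ` is determined by its images modulo `T` and `N`, so the chosen lifts are
  -- multiplicative.
  choose f hf1 hf2 using h
  have huniq : ∀ y z : Γ, (y : Γ ⧸ T) = z → (y : Γ ⧸ N) = z → y = z := fun y z h1 h2 =>
    inv_mul_eq_one.1 (hTN _ (QuotientGroup.eq.1 h1) (QuotientGroup.eq.1 h2))
  let ψ : Γ →* Γ := MonoidHom.mk' f fun x y => by
    apply huniq
    · rw [QuotientGroup.mk_mul, hf1, hf1, hf1, QuotientGroup.mk_mul, map_mul]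
    · rw [QuotientGroup.mk_mul, hf2, hf2, hf2, map_mul]
  have hψ : ∀ x : Γ, (ψ x : Γ ⧸ T) = φ x := hf1
  have hT : ∀ x, ψ x ∈ T ↔ x ∈ T := fun x => by
    rw [← QuotientGroup.eq_one_iff, hψ, EmbeddingLike.map_eq_one_iff, QuotientGroup.eq_one_iff]
  have hinj : Function.Injective ψ := by
    rw [injective_iff_map_eq_one]
    intro x hx
    refine hTN x ((hT x).1 (hx ▸ one_mem T)) (hA x ?_)
    rw [← hf2 x]
    change ((ψ x : Γ) : Γ ⧸ N) = 1
    rw [hx, QuotientGroup.mk_one]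
  -- Surjectivity modulo `T` comes from `φ`; on the finite group `T` it follows from injectivity.
  have hTsurj : ∀ t ∈ T, ∃ t', ψ t' = t := by
    let r : T → T := fun t => ⟨ψ t, (hT t).2 t.2⟩
    have hr : Function.Injective r := fun s t hst =>
      Subtype.ext (hinj (congrArg Subtype.val hst))
    intro t ht
    obtain ⟨s, hs⟩ := Finite.surjective_of_injective hr ⟨t, ht⟩
    exact ⟨s, congrArg Subtype.val hs⟩
  have hsurj : Function.Surjective ψ := by
    intro z
    obtain ⟨x, hx⟩ := QuotientGroup.mk_surjective (φ.symm z)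
    have h1 : (ψ x : Γ ⧸ T) = z := by rw [hψ, hx, MulEquiv.apply_symm_apply]
    obtain ⟨t, ht⟩ := hTsurj _ (QuotientGroup.eq.1 h1)
    exact ⟨x * t, by rw [map_mul, ht, mul_inv_cancel_left]⟩
  exact ⟨MulEquiv.ofBijective ψ ⟨hinj, hsurj⟩, fun x => ⟨hf1 x, hf2 x⟩⟩

end Glue

/-! ### Automorphisms of the completion seen at finite levels. -/

section Completion

theorem proj_completionMap {G H : Type u} [Group G] [Group H] (f : G →* H)
    (W : FiniteIndexNormalSubgroup G) (M : FiniteIndexNormalSubgroup H)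
    (h : W.toSubgroup ≤ M.toSubgroup.comap f) (z : Completion G) :
    proj M (completionMap f z) = QuotientGroup.map _ _ f h (proj W z) := by
  let _ : TopologicalSpace (H ⧸ M.toSubgroup) := ⊥
  have : DiscreteTopology (H ⧸ M.toSubgroup) := ⟨rfl⟩
  refine congrFun (completionMap_ext
    ((isLocallyConstant_proj M).continuous.comp (completionMap f).continuous_toFun)
    ((isLocallyConstant_proj W).comp (QuotientGroup.map _ _ f h)).continuous fun g => ?_) z
  change proj M (completionMap f (toCompletion G g)) = _
  rw [completionMap_toCompletion]
  rfl

variable {Γ : Type u} [Group Γ]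

/-- The intersection of the kernels of all homomorphisms to a given group defines an invariant
subgroup of the completion. -/
theorem proj_apply_eq_one {F : Type u} [Group F] {N : FiniteIndexNormalSubgroup Γ}
    (hN : N.toSubgroup = ⨅ f : Γ →* F, f.ker) (α : ContAut (Completion Γ)) {z : Completion Γ}
    (hz : proj N z = 1) : proj N (α.1 z) = 1 := by
  have hle : ∀ f : Γ →* F, N.toSubgroup ≤ f.ker := fun f => hN ▸ iInf_le _ f
  let _ : TopologicalSpace F := ⊥
  have : DiscreteTopology F := ⟨rfl⟩
  obtain ⟨g, hg⟩ := QuotientGroup.mk_surjective (proj N (α.1 z))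
  rw [← hg, QuotientGroup.eq_one_iff, hN, Subgroup.mem_iInf]
  intro f
  -- Composing `f` with `α` and restricting to `Γ` gives another homomorphism to `F`, which also
  -- factors through `N`.
  let f' : Γ →* F := (((QuotientGroup.lift N.toSubgroup f (hle f)).comp (proj N)).comp
    α.1.toMonoidHom).comp (toCompletion Γ)
  have key : ∀ z, QuotientGroup.lift N.toSubgroup f (hle f) (proj N (α.1 z)) =
      QuotientGroup.lift N.toSubgroup f' (hle f') (proj N z) := fun z =>
    congrFun (completionMap_ext
      (((isLocallyConstant_proj N).comp (QuotientGroup.lift N.toSubgroup f (hle f))).continuous.comp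
        α.2.1)
      ((isLocallyConstant_proj N).comp (QuotientGroup.lift N.toSubgroup f' (hle f'))).continuous
      fun g => rfl) z
  have h1 := key z
  rw [hz, map_one, ← hg] at h1
  exact h1

theorem mem_sup_of_mem_iaStarHat {α : ContAut (Completion Γ)} (hα : α ∈ IAStarHat Γ)
    (W : FiniteIndexNormalSubgroup Γ) {x y : Γ}
    (h : proj W (α.1 (toCompletion Γ x)) = (y : Γ ⧸ W.toSubgroup)) :
    x⁻¹ * y ∈ (toStar Γ).ker ⊔ W.toSubgroup := by
  have hsurj : Function.Surjective (toStar Γ) :=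
    (QuotientGroup.mk'_surjective _).comp QuotientGroup.mk_surjective
  have hM : ((W.toSubgroup).map (toStar Γ)).Normal := Subgroup.Normal.map inferInstance _ hsurj
  have hle : W.toSubgroup ≤ ((W.toSubgroup).map (toStar Γ)).comap (toStar Γ) :=
    Subgroup.le_comap_map _ _
  have hfi : ((W.toSubgroup).map (toStar Γ)).FiniteIndex := by
    refine ⟨fun h0 => ?_⟩
    have := Subgroup.index_map_dvd W.toSubgroup hsurj
    rw [h0, zero_dvd_iff] at this
    exact Subgroup.FiniteIndex.index_ne_zero this
  let M : FiniteIndexNormalSubgroup (Star Γ) := ⟨(W.toSubgroup).map (toStar Γ), hM, hfi⟩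
  have h1 := proj_completionMap (toStar Γ) W M hle (α.1 (toCompletion Γ x))
  rw [hα, proj_completionMap (toStar Γ) W M hle, h, proj_toCompletion] at h1
  have h2 : (toStar Γ x)⁻¹ * toStar Γ y ∈ (W.toSubgroup).map (toStar Γ) := QuotientGroup.eq.1 h1
  rw [← map_inv, ← map_mul, ← Subgroup.mem_comap, Subgroup.comap_map_eq, sup_comm] at h2
  exact h2

end Completion

section Approximation

variable (Γ : Type u) [Group Γ] [Group.FG Γ] [Group.IsNilpotent Γ]

/-- Here `T` is a finite term of the isolated series. Modulo `T` that series is a finite filtration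
with torsion free quotients, which near-homomorphisms trivial on `Γ*` respect, so
`hasApproximation_of_isIsolated` applies. -/
theorem exists_mulAut_quotient_approximation :
    ∃ (T : Subgroup Γ) (_ : T.Normal), Finite T ∧ ∀ W : Subgroup Γ, W.Normal → W.FiniteIndex →
      ∃ W' : Subgroup Γ, W'.Normal ∧ W'.FiniteIndex ∧ W' ≤ W ∧
        ∀ a : Γ → Γ, IsHomMod W' a → (∀ x, x⁻¹ * a x ∈ isolated Γ 1 ⊔ W') →
          ∃ φ : MulAut (Γ ⧸ T), ∀ x y : Γ, (y : Γ ⧸ T) = φ x →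
            x⁻¹ * y ∈ isolated Γ 1 ∧ y⁻¹ * a x ∈ W ⊔ T := by
  obtain ⟨c, hfin⟩ := exists_finite_isolated (Γ := Γ)
  have hF := isCentralFiltration_isolated (Γ := Γ)
  let T := isolated Γ (c + 1)
  let q := mk' T
  have hq : Function.Surjective q := mk'_surjective T
  have hker : ∀ {i}, i ≤ c + 1 → T ≤ isolated Γ i := fun h => hF.antitone h
  have hbot : ∀ {i}, c + 1 ≤ i → (isolated Γ i).map q = ⊥ := by
    intro i hi
    rw [eq_bot_iff]
    rintro _ ⟨x, hx, rfl⟩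
    exact (QuotientGroup.eq_one_iff x).2 (hF.antitone hi hx)
  have hmem : ∀ {i}, i ≤ c + 1 → ∀ {x}, q x ∈ (isolated Γ i).map q → x ∈ isolated Γ i := by
    intro i hi x hx
    rw [← Subgroup.mem_comap, Subgroup.comap_map_eq, ker_mk'] at hx
    exact (sup_le le_rfl (hker hi)) hx
  have hFq : IsCentralFiltration fun i => (isolated Γ i).map q :=
    { normal := fun i => Subgroup.Normal.map inferInstance q hq
      zero := by rw [hF.zero, Subgroup.map_top_of_surjective q hq]
      succ_le := fun i => Subgroup.map_mono (hF.succ_le i)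
      comm := by
        rintro i _ ⟨x, hx, rfl⟩ g
        obtain ⟨g, rfl⟩ := hq g
        exact ⟨_, hF.comm i x hx g, map_commutatorElement q x g⟩ }
  have hIq : IsIsolated fun i => (isolated Γ i).map q := by
    rintro i _ ⟨x, hx, rfl⟩ n hn hxn
    by_cases hi : i + 1 ≤ c + 1
    · rw [← map_pow] at hxn
      exact ⟨x, isIsolated_isolated i x hx n hn (hmem hi hxn), rfl⟩
    · rw [show q x = 1 from (QuotientGroup.eq_one_iff x).2 (hF.antitone (by lia) hx)]
      exact one_mem _
  refine ⟨T, inferInstance, hfin, fun W hWn hWf => ?_⟩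
  have hWq : (W.map q).Normal := Subgroup.Normal.map hWn q hq
  have hWqf : (W.map q).FiniteIndex := by
    refine ⟨fun h0 => ?_⟩
    have := Subgroup.index_map_dvd W hq
    rw [h0, zero_dvd_iff] at this
    exact Subgroup.FiniteIndex.index_ne_zero this
  obtain ⟨V, hVn, hVf, hVW, hV⟩ := hasApproximation_of_isIsolated (c + 1) (Γ ⧸ T) _ hFq hIq
    (hbot le_rfl) (W.map q) hWq hWqf
  have hVq := finiteIndex_comap q V
  obtain ⟨W', hW'n, hW'f, hW'W, hW'⟩ := exists_isHomMod_imp_mem_isolated c (W ⊓ V.comap q)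
    inferInstance inferInstance
  refine ⟨W', hW'n, hW'f, hW'W.trans inf_le_left, fun a ha h => ?_⟩
  have hai := hW' a ha h
  have haV : IsHomMod (V.comap q) a := ha.mono (hW'W.trans inf_le_right)
  let A : Γ →* (Γ ⧸ T) ⧸ V := MonoidHom.mk' (fun x => (mk' V) (q (a x))) fun x y => by
    rw [← map_mul, ← map_mul]
    refine (QuotientGroup.eq.2 ?_).symm
    rw [← map_inv, ← map_mul]
    exact haV x y
  -- Viewing `t ∈ T` in `isolated Γ c`, its displacement lies in `isolated Γ (c + 1) = T` up to the
  -- preimage of `V`. Hence `a` descends to `Γ ⧸ T`.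
  have hAT : T ≤ A.ker := by
    intro t ht
    have h1 := hai c le_rfl t (hF.succ_le c ht)
    obtain ⟨s, hs, w, hw, hsw⟩ := Subgroup.mem_sup_of_normal_right.1 h1
    refine (QuotientGroup.eq_one_iff (q (a t))).2 ?_
    rw [show a t = (t * s) * w by rw [mul_assoc, hsw]; group, map_mul,
      show q (t * s) = 1 from (QuotientGroup.eq_one_iff _).2 (mul_mem ht hs), one_mul]
    exact hw.2
  let Ā : Γ ⧸ T →* (Γ ⧸ T) ⧸ V := QuotientGroup.lift T A hAT
  let b : Γ ⧸ T → Γ ⧸ T := fun x => (Ā x).out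
  have hb : ∀ x, (b x : (Γ ⧸ T) ⧸ V) = Ā x := fun x => QuotientGroup.out_eq' _
  have hbm : ∀ x : Γ, (b (q x))⁻¹ * q (a x) ∈ V := fun x => QuotientGroup.eq.1 (hb (q x))
  obtain ⟨φ, hφ, hφb⟩ := hV b (fun x y => by
    rw [← QuotientGroup.eq, QuotientGroup.mk_mul, hb, hb, hb, map_mul]) (by
    rintro i _ ⟨x, hx, rfl⟩
    have h2 : (q x)⁻¹ * b (q x) = q (x⁻¹ * a x) * ((b (q x))⁻¹ * q (a x))⁻¹ := by
      rw [map_mul, map_inv]; group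
    rw [h2]
    refine mul_mem ?_ (inv_mem ((le_sup_right : V ≤ _) (hbm x)))
    by_cases hi : i ≤ c
    · obtain ⟨s, hs, w, hw, hsw⟩ := Subgroup.mem_sup_of_normal_right.1 (hai i hi x hx)
      rw [← hsw, map_mul]
      exact mul_mem (le_sup_left (b := V) ⟨s, hs, rfl⟩) ((le_sup_right : V ≤ _) hw.2)
    · have hxT : x ∈ T := hF.antitone (by lia) hx
      refine (le_sup_right : V ≤ _) ((QuotientGroup.eq_one_iff (q (x⁻¹ * a x))).1 ?_)
      rw [map_mul, map_inv, show q x = 1 from (QuotientGroup.eq_one_iff x).2 hxT, inv_one, one_mul]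
      exact hAT hxT)
  refine ⟨φ, fun x y hy => ⟨hmem (by lia) ?_, ?_⟩⟩
  · rw [map_mul, map_inv, show q y = φ (q x) from hy]
    exact (hφ 0 (q x) ⟨x, trivial, rfl⟩).1
  · have h3 : q (y⁻¹ * a x) ∈ W.map q := by
      rw [map_mul, map_inv, show q y = φ (q x) from hy,
        show (φ (q x))⁻¹ * q (a x) = (φ (q x))⁻¹ * b (q x) * ((b (q x))⁻¹ * q (a x)) by group]
      exact mul_mem (hφb _) (hVW (hbm x))
    rw [← Subgroup.mem_comap, Subgroup.comap_map_eq, ker_mk'] at h3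
    exact h3

variable {Γ}

/-- Modulo a finite index subgroup, an element of `IA*(Γ̂)` is given by an element of `IA*(Γ)`. -/
theorem exists_iaStar_congruent {α : ContAut (Completion Γ)} (hα : α ∈ IAStarHat Γ)
    (M : FiniteIndexNormalSubgroup Γ) :
    ∃ φ ∈ IAStar Γ, ∀ x, proj M (α.1 (toCompletion Γ x)) = (φ x : Γ ⧸ M.toSubgroup) := by
  obtain ⟨T, hTn, hTf, hT⟩ := exists_mulAut_quotient_approximation Γ
  obtain ⟨W₀, hW₀n, hW₀f, hW₀⟩ := exists_inf_le_of_pow (L := T) (B := ⊥) fun x hx =>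
    ⟨Nat.card T, Nat.card_pos, by
      have := pow_card_eq_one' (x := (⟨x, hx⟩ : T))
      exact congrArg Subtype.val this⟩
  let N₀ := M.toSubgroup ⊓ W₀
  have hfin := finite_hom (Γ := Γ) (Γ ⧸ N₀)
  -- This `N` defines a subgroup of `Γ̂` invariant under all continuous automorphisms. Applied to
  -- `α⁻¹`, the invariance yields the kernel condition required for gluing; `N ≤ W₀` makes `N` meet
  -- `T` trivially.
  obtain ⟨N, hNker⟩ : ∃ N : FiniteIndexNormalSubgroup Γ,
      N.toSubgroup = ⨅ f : Γ →* Γ ⧸ N₀, f.ker :=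
    ⟨⟨⨅ f : Γ →* Γ ⧸ N₀, f.ker, Subgroup.normal_iInf_normal fun _ => inferInstance,
      Subgroup.finiteIndex_iInf fun f => inferInstance⟩, rfl⟩
  have hN : N.toSubgroup ≤ N₀ := fun x hx =>
    (QuotientGroup.eq_one_iff x).1 (Subgroup.mem_iInf.1 (hNker.le hx) (mk' N₀))
  obtain ⟨W', hW'n, hW'f, hW'N, hW'⟩ := hT N.toSubgroup inferInstance inferInstance
  let V : FiniteIndexNormalSubgroup Γ := ⟨W', hW'n, hW'f⟩
  let a : Γ → Γ := fun x => (proj V (α.1 (toCompletion Γ x))).out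
  have ha : ∀ x, proj V (α.1 (toCompletion Γ x)) = (a x : Γ ⧸ W') := fun x =>
    (QuotientGroup.out_eq' _).symm
  have haN : ∀ x, proj N (α.1 (toCompletion Γ x)) = (a x : Γ ⧸ N.toSubgroup) := fun x => by
    rw [← map_proj (M := V) (N := N) hW'N, ha]
    rfl
  obtain ⟨φ, hφ⟩ := hW' a (fun x y => by
    rw [← QuotientGroup.eq, QuotientGroup.mk_mul, ← ha, ← ha, ← ha, map_mul, map_mul, map_mul])
    fun x => by
      rw [isolated_one_eq_ker]
      exact mem_sup_of_mem_iaStarHat hα V (ha x)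
  let A : Γ →* Γ ⧸ N.toSubgroup := ((proj N).comp α.1.toMonoidHom).comp (toCompletion Γ)
  obtain ⟨ψ, hψ⟩ := exists_mulAut_of_quotients (T := T) (N := N.toSubgroup)
    (fun x hx hxN => hW₀ ⟨(hN hxN).2, hx⟩) φ A (fun x hx => by
      have h1 := proj_apply_eq_one (N := N) hNker α⁻¹ (z := α.1 (toCompletion Γ x)) hx
      rw [show (α⁻¹).1 (α.1 (toCompletion Γ x)) = toCompletion Γ x from
        α.1.symm_apply_apply _] at h1
      exact (QuotientGroup.eq_one_iff x).1 h1) (fun x => by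
      obtain ⟨y, hy⟩ := QuotientGroup.mk_surjective (φ x)
      obtain ⟨t', ht', w', hw', hwt'⟩ := Subgroup.mem_sup_of_normal_left.1
        (show y⁻¹ * a x ∈ T ⊔ N.toSubgroup by rw [sup_comm]; exact (hφ x y hy).2)
      refine ⟨y * t', ?_, ?_⟩
      · rw [QuotientGroup.mk_mul, (QuotientGroup.eq_one_iff t').2 ht', mul_one, hy]
      · refine (QuotientGroup.eq.2 ?_).trans (haN x).symm
        rw [show (y * t')⁻¹ * a x = t'⁻¹ * (y⁻¹ * a x) by group, ← hwt', inv_mul_cancel_left]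
        exact hw')
  refine ⟨ψ, ?_, fun x => ?_⟩
  · change autStar Γ ψ = 1
    ext x
    obtain ⟨x, rfl⟩ := QuotientGroup.mk_surjective x
    obtain ⟨x, rfl⟩ := QuotientGroup.mk_surjective x
    change autStar Γ ψ (toStar Γ x) = toStar Γ x
    have h1 := (hφ x (ψ x) (hψ x).1).1
    rw [isolated_one_eq_ker, MonoidHom.mem_ker, map_mul, map_inv, inv_mul_eq_one] at h1
    rw [autStar_toStar, h1]
  · rw [← map_proj (M := N) (N := M) (hN.trans inf_le_left)]
    have h1 : proj N (α.1 (toCompletion Γ x)) = ψ x := (hψ x).2.symm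
    rw [h1]
    rfl

end Approximation

/-! ### The congruence subgroup property -/

section CongruenceSubgroup

variable {Γ : Type u} [Group Γ]

theorem isCentralFiltration_lowerCentralSeries :
    IsCentralFiltration (Subgroup.lowerCentralSeries (⊤ : Subgroup Γ)) where
  normal _ := inferInstance
  zero := rfl
  succ_le i := Subgroup.commutator_le_left (Subgroup.lowerCentralSeries (⊤ : Subgroup Γ) i) ⊤
  comm _ _ hx g := Subgroup.commutator_mem_commutator hx (Subgroup.mem_top g)

/-- Each term is generated by commutators `⁅k, g⁆`, and the displacements of `k` and `g` do not
affect them two steps further down. -/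
theorem inv_mul_apply_mem_lowerCentralSeries {φ : MulAut Γ}
    (h : ∀ x, x⁻¹ * φ x ∈ ⁅(⊤ : Subgroup Γ), (⊤ : Subgroup Γ)⁆) (i : ℕ) :
    ∀ x ∈ Subgroup.lowerCentralSeries (⊤ : Subgroup Γ) i,
      x⁻¹ * φ x ∈ Subgroup.lowerCentralSeries (⊤ : Subgroup Γ) (i + 1) := by
  have hF := isCentralFiltration_lowerCentralSeries (Γ := Γ)
  induction i with
  | zero => exact fun x _ => h x
  | succ i ih =>
    let Q := Subgroup.lowerCentralSeries (⊤ : Subgroup Γ) (i + 2)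
    have key : ⁅Subgroup.lowerCentralSeries (⊤ : Subgroup Γ) i, (⊤ : Subgroup Γ)⁆ ≤
        (mk' Q).eqLocus ((mk' Q).comp φ.toMonoidHom) := by
      rw [Subgroup.commutator_le]
      intro k hk g _
      change mk' Q ⁅k, g⁆ = mk' Q (φ ⁅k, g⁆)
      obtain ⟨ψ, hψ, hker⟩ := hF.exists_commutator_hom hk
      have e1 : Commute (mk' Q (k⁻¹ * φ k)) (mk' Q g * mk' Q (g⁻¹ * φ g)) :=
        hF.commute_mk (ih k hk) _
      have e2 : Commute (mk' Q k) (mk' Q (g⁻¹ * φ g)) := by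
        have h1 := hker (h g)
        rw [MonoidHom.mem_ker, hψ, QuotientGroup.eq_one_iff] at h1
        exact commute_mk_of_commutator_mem h1
      have h2 := commutator_mul_mul_of_commute e1 e2
      rw [← map_mul, ← map_mul, mul_inv_cancel_left, mul_inv_cancel_left] at h2
      rw [map_commutatorElement φ, map_commutatorElement, map_commutatorElement, h2]
    exact fun x hx => QuotientGroup.eq.1 (key hx)

theorem mem_stability_lowerCentralSeries {φ : MulAut Γ}
    (h : ∀ x, x⁻¹ * φ x ∈ ⁅(⊤ : Subgroup Γ), (⊤ : Subgroup Γ)⁆) :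
    φ ∈ stability (isCentralFiltration_lowerCentralSeries (Γ := Γ)) := by
  refine fun i x hx => ⟨inv_mul_apply_mem_lowerCentralSeries h i x hx,
    inv_mul_apply_mem_lowerCentralSeries (φ := φ.symm) (fun x => ?_) i x hx⟩
  have h1 := inv_mem (h (φ.symm x))
  rwa [MulEquiv.apply_symm_apply, mul_inv_rev, inv_inv] at h1

theorem inv_mul_apply_mem_ker_toStar {φ : MulAut Γ} (hφ : φ ∈ IAStar Γ) (x : Γ) :
    x⁻¹ * φ x ∈ (toStar Γ).ker := by
  rw [MonoidHom.mem_ker, map_mul, map_inv, ← autStar_toStar, show autStar Γ φ = 1 from hφ,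
    MulAut.one_apply, inv_mul_cancel]

/-- Displacements under `IA*(Γ)` are torsion modulo `[Γ, Γ]`, so those lying in a deep `M₂` lie in
`[Γ, Γ]`. Thus `G(M₂)` is contained in `G₀`, which acts unipotently on the lower central series, and
`exists_congruence_le` applies to `G₀`. -/
theorem isCongruenceSubgroup_of_le_iaStar [Group.FG Γ] [hn : Group.IsNilpotent Γ]
    {G : Subgroup (MulAut Γ)} (hG : G ≤ IAStar Γ) (H : Subgroup G) [hH : H.FiniteIndex] :
    IsCongruenceSubgroup G H := by
  let C := ⁅(⊤ : Subgroup Γ), (⊤ : Subgroup Γ)⁆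
  obtain ⟨W, hWn, hWf, hW⟩ := exists_inf_le_of_pow (L := isolated Γ 1) (B := C)
    fun x hx => exists_pow_mem_of_mem_isolated_succ (i := 0) hx
  obtain ⟨M₂, hM₂c, hM₂f, hM₂⟩ := exists_characteristic_le W
  let G₀ : Subgroup G := congruence G.subtype C
  obtain ⟨c, hc⟩ := Subgroup.nilpotent_iff_lowerCentralSeries.1 hn
  obtain ⟨M₁, hM₁c, hM₁f, hM₁⟩ := exists_congruence_le (G.subtype.comp G₀.subtype)
    isCentralFiltration_lowerCentralSeries
    (fun g => mem_stability_lowerCentralSeries ((mem_congruence G.subtype).1 g.2)) hc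
    (H.subgroupOf G₀) (by
      intro g hg
      have h1 : g = 1 := Subtype.ext (Subtype.ext hg)
      rw [h1]
      exact one_mem _)
  refine ⟨hH, M₁ ⊓ M₂, Subgroup.characteristic_inf, inferInstance, fun g hg => ?_⟩
  have hg' : ∀ x, x⁻¹ * g.1 x ∈ M₁ ⊓ M₂ := (mem_congruence G.subtype).1 hg
  have hg₀ : g ∈ G₀ := (mem_congruence G.subtype).2 fun x => hW
    ⟨hM₂ (hg' x).2, by
      rw [isolated_one_eq_ker]; exact inv_mul_apply_mem_ker_toStar (hG g.2) x⟩
  exact hM₁ (show (⟨g, hg₀⟩ : G₀) ∈ _ from (mem_congruence _).2 fun x => (hg' x).1)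

theorem congruenceKernel_eq_bot [Group.FG Γ] {G : Subgroup (MulAut Γ)}
    (h : ∀ H : Subgroup G, H.FiniteIndex → IsCongruenceSubgroup G H) :
    congruenceKernel G = ⊥ := by
  rw [eq_bot_iff]
  intro g hg
  have hact : ∀ x, act G g x = x := fun x => DFunLike.congr_fun (congrArg Subtype.val hg) x
  refine completion_ext fun N => ?_
  obtain ⟨-, M, hM, hMf, hMN⟩ := h N.toSubgroup inferInstance
  let M' : FiniteIndexNormalSubgroup Γ := ⟨M, inferInstance, hMf⟩
  have : M'.toSubgroup.Characteristic := hM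
  have h1 : levelMap G M' g = 1 := by
    ext x
    obtain ⟨x, rfl⟩ := QuotientGroup.mk_surjective x
    rw [← proj_toCompletion, ← proj_act, hact]
    rfl
  have h2 : proj (principalFI G M') g = 1 :=
    QuotientGroup.kerLift_injective _ (h1.trans (map_one _).symm)
  rw [← map_proj (M := principalFI G M') (N := N) hMN, h2, map_one, map_one]

theorem toCompletion_injective [Group.FG Γ] [Group.IsNilpotent Γ] :
    Function.Injective (toCompletion Γ) := by
  rw [injective_iff_map_eq_one]
  intro x hx
  by_contra hne
  obtain ⟨N, hNn, hNf, hN⟩ := exists_normal_finiteIndex_notMem hne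
  have h1 := congrArg (proj ⟨N, hNn, hNf⟩) hx
  rw [proj_toCompletion, map_one] at h1
  exact hN ((QuotientGroup.eq_one_iff x).1 h1)

theorem autCompletion_injective [Group.FG Γ] [Group.IsNilpotent Γ] :
    Function.Injective (autCompletion Γ) := fun φ ψ h => MulEquiv.ext fun x =>
  toCompletion_injective (by rw [← autCompletion_toCompletion, h, autCompletion_toCompletion])

end CongruenceSubgroup

/-! ### Density -/

section Density

variable {Γ : Type u} [Group Γ]

theorem proj_eq_of_le {M N : FiniteIndexNormalSubgroup Γ} (h : M ≤ N) {y z : Completion Γ}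
    (hyz : proj M z = proj M y) : proj N z = proj N y := by
  rw [← map_proj (M := M) (N := N) h, hyz, map_proj]

theorem exists_proj_eq_subset {U : Set (Completion Γ)} (hU : IsOpen U) {y : Completion Γ}
    (hy : y ∈ U) : ∃ M, {z | proj M z = proj M y} ⊆ U := by
  have : Nonempty (FiniteIndexNormalSubgroup Γ) := ⟨⟨⊤, inferInstance, inferInstance⟩⟩
  refine exists_subset_nhds_of_compactSpace (V := fun M => {z | proj M z = proj M y})
    (fun M M' => ⟨M ⊓ M', fun z hz => proj_eq_of_le inf_le_left hz,
      fun z hz => proj_eq_of_le inf_le_right hz⟩)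
    (fun M => (isLocallyConstant_proj M).isClosed_fiber _) fun z hz => ?_
  rw [completion_ext fun M => Set.mem_iInter.1 hz M]
  exact hU.mem_nhds hy

/-- Compactness of `K` makes the level `M` uniform, which connects the compact-open topology with
congruence modulo `M`. -/
theorem exists_proj_eq_imp_mem {K U : Set (Completion Γ)} (hK : IsCompact K) (hU : IsOpen U)
    (hKU : K ⊆ U) : ∃ M, ∀ y ∈ K, ∀ z, proj M z = proj M y → z ∈ U := by
  refine hK.induction_on (p := fun s => ∃ M, ∀ y ∈ s, ∀ z, proj M z = proj M y → z ∈ U)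
    ⟨⟨⊤, inferInstance, inferInstance⟩, fun y hy => hy.elim⟩
    (fun s t hst ⟨M, hM⟩ => ⟨M, fun y hy => hM y (hst hy)⟩) ?_ ?_
  · rintro s t ⟨M, hM⟩ ⟨M', hM'⟩
    refine ⟨M ⊓ M', fun y hy z hz => ?_⟩
    rcases hy with hy | hy
    · exact hM y hy z (proj_eq_of_le inf_le_left hz)
    · exact hM' y hy z (proj_eq_of_le inf_le_right hz)
  · intro y hy
    obtain ⟨M, hM⟩ := exists_proj_eq_subset hU (hKU hy)
    exact ⟨{z | proj M z = proj M y},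
      mem_nhdsWithin_of_mem_nhds (((isLocallyConstant_proj M).isOpen_fiber _).mem_nhds rfl),
      M, fun z hz w hw => hM (hw.trans hz)⟩

theorem denseRange_iaCompletion [Group.FG Γ] [Group.IsNilpotent Γ] :
    DenseRange (iaCompletion Γ) := by
  intro α
  choose φ hφ hφα using fun M => exists_iaStar_congruent α.2 M
  have hcongr : ∀ M z, proj M ((autCompletion Γ (φ M)).1 z) = proj M (α.1.1 z) := fun M z => by
    let _ : TopologicalSpace (Γ ⧸ M.toSubgroup) := ⊥
    have : DiscreteTopology (Γ ⧸ M.toSubgroup) := ⟨rfl⟩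
    refine congrFun (completionMap_ext
      ((isLocallyConstant_proj M).continuous.comp (autCompletion Γ (φ M)).2.1)
      ((isLocallyConstant_proj M).continuous.comp α.1.2.1) fun g => ?_) z
    change proj M ((autCompletion Γ (φ M)).1 (toCompletion Γ g)) = _
    rw [autCompletion_toCompletion, proj_toCompletion]
    exact (hφα M g).symm
  have : Nonempty (FiniteIndexNormalSubgroup Γ) := ⟨⟨⊤, inferInstance, inferInstance⟩⟩
  -- The approximations form a net converging to `α`; smaller subgroups give better ones, hence
  -- `Filter.atBot`.
  refine mem_closure_of_tendsto (f := fun M => iaCompletion Γ ⟨φ M, hφ M⟩)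
    (b := Filter.atBot) ?_ (Filter.Eventually.of_forall fun M => ⟨_, rfl⟩)
  have hind : Topology.IsInducing (fun β : IAStarHat Γ => ContAut.toContinuousMap β.1) :=
    (Topology.IsInducing.mk rfl : Topology.IsInducing
      (ContAut.toContinuousMap (X := Completion Γ))).comp Topology.IsInducing.subtypeVal
  rw [hind.tendsto_nhds_iff, ContinuousMap.tendsto_nhds_compactOpen]
  intro K hK U hU hKU
  obtain ⟨M, hM⟩ := exists_proj_eq_imp_mem (hK.image α.1.2.1) hU hKU.image_subset
  filter_upwards [Filter.eventually_le_atBot M] with M' hM' z hz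
  refine hM _ ⟨z, hz, rfl⟩ _ ?_
  change proj M ((autCompletion Γ (φ M')).1 z) = proj M (α.1.1 z)
  rw [← map_proj (M := M') (N := M) hM', hcongr, map_proj]

end Density

end NilpotentCSP

open NilpotentCSP in
theorem theorem1p4 (Γ : Type*) [Group Γ] [Group.FG Γ] [Group.IsNilpotent Γ] :
    (∀ (G : Subgroup (MulAut Γ)) (hG : G ≤ IAStar Γ),
      Function.Injective ((iaCompletion Γ).comp (Subgroup.inclusion hG)) ∧
      Function.Injective (iaCongruenceMap hG) ∧
      congruenceKernel G = ⊥ ∧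
      ∀ H : Subgroup G, H.FiniteIndex → IsCongruenceSubgroup G H) ∧
    DenseRange (iaCompletion Γ) := by
  refine ⟨fun G hG => ?_, denseRange_iaCompletion⟩
  have hcong : ∀ H : Subgroup G, H.FiniteIndex → IsCongruenceSubgroup G H := fun H _ =>
    isCongruenceSubgroup_of_le_iaStar hG H
  have hker := congruenceKernel_eq_bot hcong
  refine ⟨fun g h hgh => ?_, fun g h hgh => ?_, hker, hcong⟩
  · exact Subtype.ext (autCompletion_injective (congrArg Subtype.val hgh))
  · exact (MonoidHom.ker_eq_bot_iff _).1 hker (congrArg Subtype.val hgh)
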